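/- Let $\mathcal G$ be a weighted digraph with nodes $1,\dots,n$ ($n\ge 1$), $m$ arcs, and arc weights $w_{ij}\ge 0$ ($w_{ij}=0$ if $i\to j$ is not an arc). Put $d_i=\sum_j w_{ij}$ and $\mathbf L=\mathrm{diag}(d_1,\dots,d_n)-(w_{ij})$. The case of interest is the projected digraph of a hypergraph with hyperedge set $E$, hyperedge weights $h(e)\ge 0$ and contribution proportions $\gamma_e(i)\ge 0$ with $\sum_{i\in e}\gamma_e(i)=1$: its arcs are the pairs $i\to j$, $i\ne j$, with $i,j\in e$ for some $e\in E$, and $w_{ij}=\sum_{e\in E:\,i,j\in e} 2h(e)\gamma_e(j)/(|e|-1)$. An in-forest (spanning converging forest) of $\mathcal G$ is a set of arcs for which, in every weakly connected component of the resulting spanning subdigraph, one node (the root) has out-degree $0$ and all other nodes have out-degree $1$; its weight $\varepsilon$ is the product of its arc weights ($1$ if it has no arcs). Let $\Gamma$ be the set of all in-forests, $\Gamma_{ij}\subseteq\Gamma$ the set of those in which $i$ and $j$ lie in the same component with root $j$, and let $\phi$ be a random in-forest drawn with probability proportional to its weight. Let $x\in\mathbb R^n$ be the vector of internal opinions and let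 $\tau\ge 1$. Algorithm $\textsc{Sample}(\mathcal G,x,\tau)$ performs $\tau$ rounds. In each round it starts with the empty forest and, for $i=1,\dots,n$ in turn, walks from $u=i$ until it reaches a node already in the forest: at a node $u$ not in the forest it draws a uniform seed in $(0,1)$; if the seed is at most $1/(1+d_u)$, then $u$ joins the forest as a root, and otherwise the walk moves to a random successor $v$ of $u$ (chosen with probability $w_{uv}/d_u$), recording $v$ as the next node of $u$ and overwriting earlier records. Then the nodes met by following the recorded next nodes from $i$ join the forest, with the root of the node at which the walk ended. After the round, $x_{r(i)}/\tau$ is added to $\widehat z_i$ (initially $0$) for every $i$, where $r(i)$ is the root of $i$. Finally the algorithm returns $\widehat z$, together with $\sum_i\bigl(\widehat z_i-\frac1n\sum_k\widehat z_k\bigr)^2$. Elementary operations cost $1$, and drawing a random successor of $u$ costs the number of arcs leaving $u$. Then: 1. $\mathbf I+\mathbf L$ is invertible, and from every starting vector the Friedkin--Johnsen opinions $x_i^{(k+1)}=\dfrac{x_i+\sum_{j:\,i\to j}w_{ij}x_j^{(k)}}{1+\sum_{j:\,i\to j}w_{ij}}$ converge to $z=(\mathbf I+\mathbf L)^{-1}x$.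 2. $z_i=\sum_{j=1}^n \mathbb P(\phi\in\Gamma_{ij})\,x_j$ for every $i$. 3. In each round, with probability one, the algorithm completes an in-forest in which $r(i)$ is the root of $i$ for every $i$, and it obtains each in-forest with probability proportional to its weight. 4. For every $\tau\ge1$ the algorithm halts with probability one, and $\mathbb E[\widehat z_i]=z_i$ for every $i$. 5. The algorithm has expected running time $O(\tau(n+m))$ for bounded arc weights: there is an absolute constant $C$ such that, whenever all $w_{ij}\le W$, the expected number of operations is at most $C(1+W)\,\tau\,(n+m)$. -/

import Mathlib

open Filter Topology
open scoped ENNReal BigOperators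

/-! ### Weighted digraphs, Laplacian, Friedkin–Johnsen dynamics -/

/-- A weighted digraph on the nodes `Fin n`: a set of arcs, with nonnegative weights that vanish
off the arcs. The arc `i → j` is the pair `(i, j)`. -/
structure WeightedDigraph (n : ℕ) where
  arcs : Finset (Fin n × Fin n)
  w : Fin n → Fin n → ℝ
  w_nonneg : ∀ i j, 0 ≤ w i j
  w_eq_zero : ∀ i j, (i, j) ∉ arcs → w i j = 0

namespace WeightedDigraph

variable {n : ℕ}

/-- The out-neighbours of `i`. -/
def outNbrs (G : WeightedDigraph n) (i : Fin n) : Finset (Fin n) :=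
  Finset.univ.filter fun j => (i, j) ∈ G.arcs

/-- The weighted out-degree `d_i`. -/
def deg (G : WeightedDigraph n) (i : Fin n) : ℝ := ∑ j, G.w i j

/-- The Laplacian `L = D - A`. -/
def laplacian (G : WeightedDigraph n) : Matrix (Fin n) (Fin n) ℝ :=
  Matrix.diagonal G.deg - Matrix.of G.w

/-- One step of the Friedkin–Johnsen dynamics with internal opinions `x`. -/
noncomputable def fjUpdate (G : WeightedDigraph n) (x y : Fin n → ℝ) : Fin n → ℝ := fun i =>
  (x i + ∑ j ∈ G.outNbrs i, G.w i j * y j) / (1 + ∑ j ∈ G.outNbrs i, G.w i j)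

/-- The vector `(I + L)⁻¹ x`. -/
noncomputable def equilibrium (G : WeightedDigraph n) (x : Fin n → ℝ) : Fin n → ℝ :=
  (1 + G.laplacian)⁻¹.mulVec x

/-! ### Spanning converging forests (in-forests)

A spanning subdigraph is given by its set of arcs. -/

/-- `i` and `j` lie in the same weakly connected component of the spanning subdigraph `F`. -/
def SameComponent (F : Finset (Fin n × Fin n)) (i j : Fin n) : Prop :=
  Relation.EqvGen (fun a b => (a, b) ∈ F) i j

/-- The number of arcs of `F` leaving `i`. -/
def outCount (F : Finset (Fin n × Fin n)) (i : Fin n) : ℕ :=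
  (F.filter fun e => e.1 = i).card

/-- `F` is a spanning converging forest of `G`: a set of arcs of `G` such that in every weakly
connected component one node has out-degree `0` and every other node has out-degree `1`. -/
def IsInForest (G : WeightedDigraph n) (F : Finset (Fin n × Fin n)) : Prop :=
  F ⊆ G.arcs ∧ ∀ i, ∃ r, SameComponent F i r ∧ outCount F r = 0 ∧
    ∀ v, SameComponent F i v → v ≠ r → outCount F v = 1

open scoped Classical in
/-- `Γ`, the set of all in-forests of `G`. -/
noncomputable def inForests (G : WeightedDigraph n) : Finset (Finset (Fin n × Fin n)) :=
  G.arcs.powerset.filter G.IsInForest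

open scoped Classical in
/-- `Γ_ij`: the in-forests in which `i` and `j` are in the same in-tree and `j` is its root. -/
noncomputable def inForestsRootedAt (G : WeightedDigraph n) (i j : Fin n) :
    Finset (Finset (Fin n × Fin n)) :=
  G.inForests.filter fun F => SameComponent F i j ∧ outCount F j = 0

/-- The weight `ε(F)`: the product of the weights of the arcs of `F`. -/
def forestWeight (G : WeightedDigraph n) (F : Finset (Fin n × Fin n)) : ℝ :=
  ∏ e ∈ F, G.w e.1 e.2

theorem empty_mem_inForests (G : WeightedDigraph n) : ∅ ∈ G.inForests := by
  classical
  simp only [inForests, Finset.mem_filter, Finset.mem_powerset, Finset.empty_subset, true_and]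
  refine ⟨Finset.empty_subset _, fun i => ⟨i, Relation.EqvGen.refl i, by simp [outCount], ?_⟩⟩
  have key : ∀ a b : Fin n, SameComponent (∅ : Finset (Fin n × Fin n)) a b → a = b := by
    intro a b h
    induction h with
    | rel a b h => simp at h
    | refl a => rfl
    | symm a b _ ih => exact ih.symm
    | trans a b c _ _ ih1 ih2 => exact ih1.trans ih2
  intro v hv hne
  exact absurd (key i v hv).symm hne

open scoped Classical in
/-- The weight `ε(F)` of an in-forest, and `0` for every other set of arcs. -/
noncomputable def forestMass (G : WeightedDigraph n) (F : Finset (Fin n × Fin n)) : ℝ≥0∞ :=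
  if F ∈ G.inForests then ENNReal.ofReal (G.forestWeight F) else 0

theorem tsum_forestMass_ne_zero (G : WeightedDigraph n) : ∑' F, G.forestMass F ≠ 0 := by
  intro h
  have h0 := ENNReal.tsum_eq_zero.1 h ∅
  simp [forestMass, G.empty_mem_inForests, forestWeight] at h0

theorem tsum_forestMass_ne_top (G : WeightedDigraph n) : ∑' F, G.forestMass F ≠ ∞ := by
  rw [tsum_fintype]
  refine ENNReal.sum_ne_top.2 fun F _ => ?_
  unfold forestMass
  split_ifs <;> simp

/-- The law of a random in-forest drawn with probability proportional to its weight. -/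
noncomputable def forestPMF (G : WeightedDigraph n) : PMF (Finset (Fin n × Fin n)) :=
  PMF.normalize G.forestMass G.tsum_forestMass_ne_zero G.tsum_forestMass_ne_top

/-- `ℙ(φ ∈ S)` for a random in-forest `φ` drawn with probability proportional to its weight. -/
noncomputable def forestProb (G : WeightedDigraph n) (S : Finset (Finset (Fin n × Fin n))) : ℝ :=
  (G.forestPMF.toOuterMeasure (S : Set (Finset (Fin n × Fin n)))).toReal

end WeightedDigraph

/-! ### Hypergraphs and their projected digraphs -/

/-- A weighted hypergraph on `Fin n`: hyperedges `e` with weights `h e` and contribution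
proportions `γ e i` of the members `i` of `e`. -/
structure WeightedHypergraph (n : ℕ) where
  edges : Finset (Finset (Fin n))
  h : Finset (Fin n) → ℝ
  γ : Finset (Fin n) → Fin n → ℝ
  h_nonneg : ∀ e ∈ edges, 0 ≤ h e
  γ_nonneg : ∀ e ∈ edges, ∀ i ∈ e, 0 ≤ γ e i
  γ_sum : ∀ e ∈ edges, ∑ i ∈ e, γ e i = 1

/-- The projected digraph of a hypergraph. -/
noncomputable def WeightedHypergraph.projectedDigraph {n : ℕ} (H : WeightedHypergraph n) :
    WeightedDigraph n where
  arcs := Finset.univ.filter fun p => p.1 ≠ p.2 ∧ ∃ e ∈ H.edges, p.1 ∈ e ∧ p.2 ∈ e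
  w i j := if i ≠ j then
      ∑ e ∈ H.edges.filter (fun e => i ∈ e ∧ j ∈ e),
        2 * (H.h e * H.γ e j * (1 / ((e.card : ℝ) - 1)))
    else 0
  w_nonneg i j := by
    split_ifs with hij
    · refine Finset.sum_nonneg fun e he => ?_
      obtain ⟨he, hi, hj⟩ := Finset.mem_filter.1 he
      have h1 : (1 : ℝ) ≤ (e.card : ℝ) := by
        exact_mod_cast Finset.card_pos.2 ⟨i, hi⟩
      exact mul_nonneg zero_le_two (mul_nonneg
        (mul_nonneg (H.h_nonneg e he) (H.γ_nonneg e he j hj))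
        (one_div_nonneg.2 (sub_nonneg.2 h1)))
    · exact le_rfl
  w_eq_zero i j hij := by
    split_ifs with hne
    · refine Finset.sum_eq_zero fun e he => ?_
      obtain ⟨he, hi, hj⟩ := Finset.mem_filter.1 he
      exact absurd (Finset.mem_filter.2 ⟨Finset.mem_univ _, hne, e, he, hi, hj⟩) hij
    · rfl

/-! ### Randomized programs with a step count -/

/-- A randomized program with results in `α`, given by the probability of every pair
(result, number of elementary operations executed). The total mass is the probability that the
program halts. -/
def RandProg (α : Type) : Type := α × ℕ → ℝ≥0∞

namespace RandProg

open scoped Classical in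
/-- Programs returning a value at no cost, and sequential composition, which adds costs. -/
noncomputable instance : Monad RandProg where
  pure a := fun o => if o = (a, 0) then 1 else 0
  bind p f := fun o =>
    ∑' a, ∑ k ∈ Finset.HasAntidiagonal.antidiagonal o.2, p (a, k.1) * f a (o.1, k.2)

/-- Execute `k` elementary operations (without changing any value). -/
def tick (k : ℕ) : RandProg Unit := fun o => if o.2 = k then 1 else 0

/-- Draw `seed` uniformly from `(0, 1)` and return the truth value of `seed ≤ p`:
two operations. -/
noncomputable def randLE (p : ℝ) : RandProg Bool := fun o =>
  if o.2 = 2 then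
    MeasureTheory.volume {seed : ℝ | seed ∈ Set.Ioo 0 1 ∧ (o.1 = true ↔ seed ≤ p)}
  else 0

/-- The loop `while cond do body`, cut off (without any result) at the `k`-th test of `cond`.
Every test costs one operation. -/
noncomputable def whileFuel {σ : Type} (cond : σ → Bool) (body : σ → RandProg σ) :
    ℕ → σ → RandProg σ
  | 0, _ => fun _ => 0
  | k + 1, s => do
    tick 1
    if cond s then
      let s' ← body s
      whileFuel cond body k s'
    else
      pure s

/-- The loop `while cond do body`: the limit (pointwise supremum) of its cut-off versions. -/
noncomputable def whileLoop {σ : Type} (cond : σ → Bool) (body : σ → RandProg σ) (s : σ) :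
    RandProg σ := fun o => ⨆ k, whileFuel cond body k s o

/-- The probability that the program halts with a result satisfying `Q`. -/
noncomputable def prob {α : Type} (p : RandProg α) (Q : α → Prop) : ℝ≥0∞ :=
  ∑' o : α × ℕ, Set.indicator {o | Q o.1} p o

/-- The expected number of operations (for a program that halts with probability one). -/
noncomputable def expectedCost {α : Type} (p : RandProg α) : ℝ≥0∞ :=
  ∑' o : α × ℕ, p o * (o.2 : ℝ≥0∞)

/-- `f` of the result has an (absolutely convergent) expectation, and it is `e`. -/
def HasExpectation {α : Type} (p : RandProg α) (f : α → ℝ) (e : ℝ) : Prop :=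
  HasSum (fun o : α × ℕ => (p o).toReal * f o.1) e

end RandProg

/-! ### The algorithm `Sample` -/

/-- The arrays `Inforest`, `Nextnode` (`none` stands for `-1`) and `Rootindex`
(`none` stands for the initial value `0`, which is no node). -/
structure SampleState (n : ℕ) where
  inforest : Fin n → Bool
  next : Fin n → Option (Fin n)
  root : Fin n → Option (Fin n)

namespace SampleState

/-- The initial arrays. -/
def init (n : ℕ) : SampleState n := ⟨fun _ => false, fun _ => none, fun _ => none⟩

/-- The set of arcs `u → Nextnode[u]`. -/
def nextArcs {n : ℕ} (s : SampleState n) : Finset (Fin n × Fin n) :=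
  Finset.univ.filter fun e => s.next e.1 = some e.2

end SampleState

namespace WeightedDigraph

open RandProg

variable {n : ℕ}

/-- `RandomSuccessor(u, G)`: a random node, equal to `v` with probability `w_uv / d_u`. It is
charged one operation for every arc leaving `u` (a scan of the list of these arcs). -/
noncomputable def randomSuccessor (G : WeightedDigraph n) (u : Fin n) : RandProg (Fin n) :=
  fun o => if o.2 = outCount G.arcs u then ENNReal.ofReal (G.w u o.1 / G.deg u) else 0

/-- The body of the first inner loop: at the current node `u`, either end the walk and make `u` a root, or
move to a random successor of `u` and record it. -/
noncomputable def walkBody (G : WeightedDigraph n) :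
    Fin n × SampleState n → RandProg (Fin n × SampleState n)
  | (u, s) => do
    let absorbed ← randLE (1 / (1 + G.deg u))
    if absorbed then
      tick 3
      pure (u, { inforest := Function.update s.inforest u true
                 next := Function.update s.next u none
                 root := Function.update s.root u (some u) })
    else
      let v ← G.randomSuccessor u
      tick 2
      pure (v, { s with next := Function.update s.next u (some v) })

/-- The body of the second inner loop: add the current node `u` to the forest with root `rootnow`
and move on to `Nextnode[u]`. -/
noncomputable def retraceBody (rootnow : Option (Fin n)) :
    Fin n × SampleState n → RandProg (Fin n × SampleState n)
  | (u, s) => do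
    tick 3
    pure ((s.next u).getD u,
      { s with
        inforest := Function.update s.inforest u true
        root := Function.update s.root u rootnow })

/-- The work done for one node `i`: walk from `i` until the current forest is hit, then retrace the
loop-erased walk and add it to the forest. -/
noncomputable def visitNode (G : WeightedDigraph n) (s : SampleState n) (i : Fin n) :
    RandProg (SampleState n) := do
  tick 2
  let (u, s) ← whileLoop (fun (u, s) => !s.inforest u) G.walkBody (i, s)
  tick 2
  let rootnow := s.root u
  let (_, s) ← whileLoop (fun (u, s) => !s.inforest u) (retraceBody rootnow) (i, s)
  pure s

/-- One round of the algorithm: reset the three arrays, then treat the nodes one by one. -/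
noncomputable def sampleForest (G : WeightedDigraph n) : RandProg (SampleState n) := do
  tick (3 * n)
  List.foldlM G.visitNode (SampleState.init n) (List.finRange n)

/-- The algorithm `Sample(G, x, τ)`. It returns the estimate `ẑ` and the polarization estimate.
The first line initializes `ẑ` and computes the table of the out-degrees `d_u`. -/
noncomputable def sample (G : WeightedDigraph n) (x : Fin n → ℝ) (τ : ℕ) :
    RandProg ((Fin n → ℝ) × ℝ) := do
  tick (2 * n + G.arcs.card)
  let zhat ← List.foldlM (fun (zhat : Fin n → ℝ) (_ : ℕ) => do
      let s ← G.sampleForest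
      tick (3 * n + 1)
      pure fun i => zhat i + (s.root i).elim 0 x / (τ : ℝ))
    (fun _ => 0) (List.range τ)
  tick (4 * n + 1)
  let mean := (∑ i, zhat i) / (n : ℝ)
  pure (zhat, ∑ i, (zhat i - mean) ^ 2)

end WeightedDigraph

/-! The forest law. An in-forest is the same as an acyclic pointer map `f`: every node chooses a
successor `v`, with weight `w u v`, or `none`, with weight `1`, which makes it a root. The weight of
`f` is a product over the nodes, so exchanging the pointer of `u` with a further choice `c` for it
preserves the weight of the pair (`mapWeight_mul_pointerWeight`, `sum_swap_pointer`). For Q_ij = ℙ(φ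
∈ Γ_ij) this exchange yields (1 + d_i) Q_ij = δ_ij + ∑_k w_ik Q_kj (`one_add_deg_mul_forestProb`),
that is, (I + L) Q = I. Invertibility and the formula for z follow. The Friedkin–Johnsen map is a
sup-norm contraction whose fixed point is z.

The law of a round. A round is Wilson's algorithm with absorption probability 1/(1 + d_u). The
argument is by stationarity instead of cycle popping. A record left over from earlier is overwritten
before it can be read, so by coupling a round from blank arrays has the law and the cost of a round
whose initial records form a random in-forest (`foldlM_visitNode_wp_eq`, `wp_foldlM_init`). During
the walk from i, give mass `density f` to each state (u, f) in which cutting the pointer of u makes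
f acyclic and the pointers lead from i to u without meeting the finished forest before. A step
resamples the pointer of u and respects these masses; a state (v, f) has at most one predecessor; an
acyclic f is left at exactly one node, any other f at none. Hence the records at the end of the walk
again follow the forest law (`sum_ev_walk`, `sum_ev_visitNode`), and so do those at the end of the
round (`ev_sampleForest`). Unbiasedness is then linearity of expectation.

The running time. The same masses count visits. A visit to u is absorbing with probability 1/(1 +
d_u), so the expected number of visits to u in a round is at most (1 + d_u) Q_uu. The diagonal of Q
(I + L) = I shows that this is 1 + ∑_k Q_uk w_ku ≤ 1 + W, because the rows of Q sum to one. A visit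
to u costs O(1 + outdegree of u), and each retracing step adds a new node to the forest, so a round
costs O((1 + W)(n + m)). -/

/-! ### Expectations of randomized programs -/

namespace RandProg

variable {α β σ : Type}

/-- The expectation of `g result cost` over the halting executions. -/
noncomputable def wp (p : RandProg α) (g : α → ℕ → ℝ≥0∞) : ℝ≥0∞ :=
  ∑' o : α × ℕ, p o * g o.1 o.2

/-- The expectation of `g result` over the halting executions. -/
noncomputable def ev (p : RandProg α) (g : α → ℝ≥0∞) : ℝ≥0∞ :=
  p.wp fun a _ => g a

theorem wp_mono {p : RandProg α} {g g' : α → ℕ → ℝ≥0∞} (h : ∀ a k, g a k ≤ g' a k) :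
    p.wp g ≤ p.wp g' :=
  ENNReal.tsum_le_tsum fun o => mul_le_mul_right (h o.1 o.2) _

theorem ev_mono {p : RandProg α} {g g' : α → ℝ≥0∞} (h : ∀ a, g a ≤ g' a) : p.ev g ≤ p.ev g' :=
  wp_mono fun a _ => h a

theorem wp_add (p : RandProg α) (g g' : α → ℕ → ℝ≥0∞) :
    (p.wp fun a k => g a k + g' a k) = p.wp g + p.wp g' := by
  simp only [wp, mul_add, ENNReal.tsum_add]

theorem ev_add (p : RandProg α) (g g' : α → ℝ≥0∞) :
    (p.ev fun a => g a + g' a) = p.ev g + p.ev g' :=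
  wp_add p _ _

theorem wp_const_mul (p : RandProg α) (c : ℝ≥0∞) (g : α → ℕ → ℝ≥0∞) :
    (p.wp fun a k => c * g a k) = c * p.wp g := by
  simp only [wp, mul_left_comm, ENNReal.tsum_mul_left]

theorem ev_const (p : RandProg α) (c : ℝ≥0∞) : (p.ev fun _ => c) = c * p.ev fun _ => 1 := by
  simpa [ev] using wp_const_mul p c fun _ _ => 1

theorem expectedCost_eq_wp (p : RandProg α) : p.expectedCost = p.wp fun _ k => (k : ℝ≥0∞) := rfl

theorem prob_eq_ev (p : RandProg α) (Q : α → Prop) [DecidablePred Q] :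
    p.prob Q = p.ev fun a => if Q a then 1 else 0 := by
  refine tsum_congr fun o => ?_
  by_cases h : Q o.1 <;> simp [Set.indicator, h]

theorem wp_pure (a : α) (g : α → ℕ → ℝ≥0∞) : wp (pure a : RandProg α) g = g a 0 := by
  classical
  have h : ∀ o : α × ℕ, (pure a : RandProg α) o = if o = (a, 0) then 1 else 0 := fun o => by
    change (if o = (a, 0) then _ else _) = _
    congr
  simp only [wp, h]
  rw [tsum_eq_single (a, 0)]
  · simp
  · intro o ho
    simp [ho]

theorem wp_bind (p : RandProg α) (f : α → RandProg β) (g : β → ℕ → ℝ≥0∞) :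
    wp (p >>= f) g = p.wp fun a k => (f a).wp fun b l => g b (k + l) := by
  have h : ∀ o : β × ℕ, (p >>= f) o =
      ∑' a, ∑ k ∈ Finset.HasAntidiagonal.antidiagonal o.2, p (a, k.1) * f a (o.1, k.2) :=
    fun _ => rfl
  simp only [wp, h, ENNReal.tsum_prod', ← ENNReal.tsum_mul_right, ← ENNReal.tsum_mul_left]
  have h1 : ∀ b : β, ∑' (l : ℕ) (a : α),
      (∑ k ∈ Finset.HasAntidiagonal.antidiagonal l, p (a, k.1) * f a (b, k.2)) * g b l =
      ∑' (a : α) (k : ℕ) (l : ℕ), p (a, k) * (f a (b, l) * g b (k + l)) := by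
    intro b
    rw [ENNReal.tsum_comm]
    refine tsum_congr fun a => ?_
    -- Pairs of costs are grouped by their sum: the antidiagonals partition `ℕ × ℕ`.
    rw [← ENNReal.tsum_prod, ← Finset.HasAntidiagonal.sigmaAntidiagonalEquivProd.tsum_eq,
      ENNReal.tsum_sigma']
    refine tsum_congr fun l => ?_
    rw [tsum_fintype, Finset.sum_mul, ← Finset.sum_coe_sort]
    refine Finset.sum_congr rfl fun k _ => ?_
    simp only [Finset.HasAntidiagonal.sigmaAntidiagonalEquivProd_apply]
    rw [Finset.HasAntidiagonal.mem_antidiagonal.1 k.2, mul_assoc]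
  simp only [h1]
  rw [ENNReal.tsum_comm]
  refine tsum_congr fun a => ?_
  rw [ENNReal.tsum_comm]

theorem ev_pure (a : α) (g : α → ℝ≥0∞) : ev (pure a : RandProg α) g = g a := wp_pure a _

theorem ev_bind (p : RandProg α) (f : α → RandProg β) (g : β → ℝ≥0∞) :
    ev (p >>= f) g = p.ev fun a => (f a).ev g := wp_bind p f _

theorem wp_tick (k : ℕ) (g : Unit → ℕ → ℝ≥0∞) : (tick k).wp g = g () k := by
  rw [wp, tsum_eq_single ((), k)]
  · simp [tick]
  · rintro ⟨⟨⟩, l⟩ hl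
    have : l ≠ k := fun h => hl (by rw [h])
    simp [tick, this]

theorem ev_tick (k : ℕ) (g : Unit → ℝ≥0∞) : (tick k).ev g = g () := wp_tick k _

/-- A program supported on executions of constant cost. -/
theorem wp_of_const_cost (q : α → ℝ≥0∞) (c : ℕ) (g : α → ℕ → ℝ≥0∞) :
    wp (fun o => if o.2 = c then q o.1 else 0 : RandProg α) g = ∑' a, q a * g a c := by
  simp only [wp]
  rw [ENNReal.tsum_prod']
  refine tsum_congr fun a => ?_
  rw [tsum_eq_single c]
  · simp
  · intro k hk
    simp [hk]

theorem wp_randLE {p : ℝ} (h0 : 0 ≤ p) (h1 : p ≤ 1) (g : Bool → ℕ → ℝ≥0∞) :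
    (randLE p).wp g = ENNReal.ofReal p * g true 2 + ENNReal.ofReal (1 - p) * g false 2 := by
  have h := wp_of_const_cost (fun b : Bool =>
    MeasureTheory.volume {seed : ℝ | seed ∈ Set.Ioo 0 1 ∧ (b = true ↔ seed ≤ p)}) 2 g
  refine h.trans ?_
  rw [tsum_fintype, Fintype.sum_bool]
  congr 2
  -- The event lies between `Ioo 0 p` and `Ioc 0 p`, which have the same volume; this also covers `p
  -- = 1`, where the seed cannot equal `p`.
  · refine le_antisymm ?_ ?_
    · refine (MeasureTheory.measure_mono (t := Set.Ioc 0 p) ?_).trans (by simp)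
      rintro x ⟨hx, hp⟩
      exact ⟨hx.1, hp.1 rfl⟩
    · refine le_trans (by simp) (MeasureTheory.measure_mono (s := Set.Ioo 0 p) ?_)
      rintro x ⟨hx, hp⟩
      exact ⟨⟨hx, hp.trans_le h1⟩, fun _ => hp.le, fun _ => rfl⟩
  · have : {seed : ℝ | seed ∈ Set.Ioo 0 1 ∧ (false = true ↔ seed ≤ p)} = Set.Ioo p 1 := by
      ext x
      simp only [Set.mem_ofPred_eq, Set.mem_Ioo, Bool.false_eq_true, false_iff, not_le]
      constructor
      · rintro ⟨⟨_, h⟩, h'⟩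
        exact ⟨h', h⟩
      · rintro ⟨h, h'⟩
        exact ⟨⟨h0.trans_lt h, h'⟩, h⟩
    rw [this, Real.volume_Ioo]

/-- The expectation of the number of operations is subadditive under sequential composition. -/
theorem expectedCost_bind_le (p : RandProg α) (f : α → RandProg β)
    (hf : ∀ a, ((f a).ev fun _ => 1) ≤ 1) :
    (p >>= f).expectedCost ≤ p.expectedCost + p.ev fun a => (f a).expectedCost := by
  simp only [expectedCost_eq_wp, wp_bind, ev, ← wp_add]
  refine wp_mono fun a k => ?_
  simp only [Nat.cast_add, wp_add]
  gcongr
  -- The cost `k` already spent is counted only on the halting executions of `f a`, whence an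
  -- inequality.
  exact (ev_const (f a) k).trans_le (mul_le_of_le_one_right' (hf a))

theorem expectedCost_pure (a : α) : (pure a : RandProg α).expectedCost = 0 := by
  simp [expectedCost_eq_wp, wp_pure]

theorem expectedCost_tick_bind (k : ℕ) (f : Unit → RandProg β) (hf : ((f ()).ev fun _ => 1) ≤ 1) :
    (tick k >>= f).expectedCost ≤ k + (f ()).expectedCost := by
  refine (expectedCost_bind_le _ _ fun _ => hf).trans_eq ?_
  rw [expectedCost_eq_wp, wp_tick, ev_tick]

theorem expectedCost_tick_pure (k : ℕ) (a : α) :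
    (tick k >>= fun _ => (pure a : RandProg α)).expectedCost = k := by
  rw [expectedCost_eq_wp, wp_bind, wp_tick, wp_pure, add_zero]

/-! ### While loops -/

theorem whileFuel_succ_eq (cond : σ → Bool) (body : σ → RandProg σ) (k : ℕ) (s : σ) :
    whileFuel cond body (k + 1) s =
      tick 1 >>= fun _ => if cond s then body s >>= whileFuel cond body k else pure s := rfl

theorem wp_whileFuel_zero (cond : σ → Bool) (body : σ → RandProg σ) (s : σ)
    (g : σ → ℕ → ℝ≥0∞) : (whileFuel cond body 0 s).wp g = 0 := by
  simp [wp, whileFuel]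

theorem wp_whileFuel_succ (cond : σ → Bool) (body : σ → RandProg σ) (k : ℕ) (s : σ)
    (g : σ → ℕ → ℝ≥0∞) :
    (whileFuel cond body (k + 1) s).wp g = if cond s then
      (body s).wp fun s' c => (whileFuel cond body k s').wp fun a l => g a (1 + (c + l))
    else g s 1 := by
  rw [whileFuel_succ_eq, wp_bind, wp_tick]
  split_ifs with h
  · rw [wp_bind]
  · rw [wp_pure]

theorem ev_whileFuel_succ (cond : σ → Bool) (body : σ → RandProg σ) (k : ℕ) (s : σ)
    (g : σ → ℝ≥0∞) :
    (whileFuel cond body (k + 1) s).ev g = if cond s then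
      (body s).ev fun s' => (whileFuel cond body k s').ev g
    else g s :=
  wp_whileFuel_succ cond body k s _

theorem bind_mono {p : RandProg α} {f f' : α → RandProg β} (h : ∀ a o, f a o ≤ f' a o)
    (o : β × ℕ) : (p >>= f) o ≤ (p >>= f') o :=
  ENNReal.tsum_le_tsum fun a => Finset.sum_le_sum fun _ _ => mul_le_mul_right (h a _) _

theorem whileFuel_le_succ (cond : σ → Bool) (body : σ → RandProg σ) (k : ℕ) (s : σ)
    (o : σ × ℕ) : whileFuel cond body k s o ≤ whileFuel cond body (k + 1) s o := by
  induction k generalizing s o with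
  | zero => exact zero_le
  | succ k ih =>
    rw [whileFuel_succ_eq, whileFuel_succ_eq]
    refine bind_mono (fun _ o => ?_) o
    split_ifs
    · exact bind_mono (fun a o => ih a o) o
    · exact le_rfl

/-- Monotone convergence: more fuel only adds halting executions, so the supremum may leave the sum.
-/
theorem wp_whileLoop (cond : σ → Bool) (body : σ → RandProg σ) (s : σ) (g : σ → ℕ → ℝ≥0∞) :
    (whileLoop cond body s).wp g = ⨆ k, (whileFuel cond body k s).wp g := by
  have hm : ∀ o, Monotone fun k => whileFuel cond body k s o := fun o =>
    monotone_nat_of_le_succ fun k => whileFuel_le_succ cond body k s o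
  simp only [wp, whileLoop, ENNReal.iSup_mul]
  simp_rw [ENNReal.tsum_eq_iSup_sum]
  rw [iSup_comm]
  refine iSup_congr fun t => ?_
  exact ENNReal.finsetSum_iSup_of_monotone fun o k l hkl => mul_le_mul_left (hm o hkl) _

theorem wp_whileFuel_le_succ (cond : σ → Bool) (body : σ → RandProg σ) (k : ℕ) (s : σ)
    (g : σ → ℕ → ℝ≥0∞) :
    (whileFuel cond body k s).wp g ≤ (whileFuel cond body (k + 1) s).wp g :=
  ENNReal.tsum_le_tsum fun o => mul_le_mul_left (whileFuel_le_succ cond body k s o) _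

theorem wp_whileFuel_mono (cond : σ → Bool) (body : σ → RandProg σ) (s : σ)
    (g : σ → ℕ → ℝ≥0∞) : Monotone fun k => (whileFuel cond body k s).wp g :=
  monotone_nat_of_le_succ fun k => wp_whileFuel_le_succ cond body k s g

theorem mass_whileFuel_le_one (cond : σ → Bool) (body : σ → RandProg σ)
    (hb : ∀ s, ((body s).ev fun _ => 1) ≤ 1) (k : ℕ) (s : σ) :
    ((whileFuel cond body k s).ev fun _ => 1) ≤ 1 := by
  induction k generalizing s with
  | zero => exact (wp_whileFuel_zero cond body s _).trans_le zero_le_one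
  | succ k ih =>
    rw [ev_whileFuel_succ]
    split_ifs
    · exact (ev_mono ih).trans (hb s)
    · exact le_rfl

theorem mass_whileLoop_le_one (cond : σ → Bool) (body : σ → RandProg σ)
    (hb : ∀ s, ((body s).ev fun _ => 1) ≤ 1) (s : σ) :
    ((whileLoop cond body s).ev fun _ => 1) ≤ 1 := by
  rw [ev, wp_whileLoop]
  exact iSup_le fun k => mass_whileFuel_le_one cond body hb k s

theorem mass_bind_le_one {p : RandProg α} {f : α → RandProg β} (hp : (p.ev fun _ => 1) ≤ 1)
    (hf : ∀ a, ((f a).ev fun _ => 1) ≤ 1) : (ev (p >>= f) fun _ => 1) ≤ 1 := by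
  rw [ev_bind]
  exact (ev_mono hf).trans hp

theorem mass_tick_bind_le_one {k : ℕ} {f : Unit → RandProg β}
    (hf : ∀ a, ((f a).ev fun _ => 1) ≤ 1) : (ev (tick k >>= f) fun _ => 1) ≤ 1 :=
  mass_bind_le_one (by rw [ev_tick]) hf

theorem mass_foldlM_le_one {ι : Type} (f : σ → ι → RandProg σ)
    (hf : ∀ s i, ((f s i).ev fun _ => 1) ≤ 1) (l : List ι) (s : σ) :
    ((List.foldlM f s l).ev fun _ => 1) ≤ 1 := by
  induction l generalizing s with
  | nil => simp [List.foldlM_nil, ev_pure]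
  | cons i l ih =>
    rw [List.foldlM_cons]
    exact mass_bind_le_one (hf s i) ih

theorem expectedCost_whileFuel_succ_le (cond : σ → Bool) (body : σ → RandProg σ)
    (hb : ∀ s, ((body s).ev fun _ => 1) ≤ 1) (k : ℕ) (s : σ) :
    (whileFuel cond body (k + 1) s).expectedCost ≤ 1 + if cond s then
      (body s).expectedCost + (body s).ev fun s' => (whileFuel cond body k s').expectedCost
    else 0 := by
  rw [whileFuel_succ_eq]
  have hm := fun s' => mass_whileFuel_le_one cond body hb k s'
  split_ifs with h
  · refine (expectedCost_tick_bind 1 _ (mass_bind_le_one (hb s) hm)).trans ?_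
    push_cast
    gcongr
    exact expectedCost_bind_le _ _ hm
  · refine (expectedCost_tick_bind 1 _ (by rw [ev_pure])).trans ?_
    rw [expectedCost_pure]
    simp

theorem expectedCost_whileLoop (cond : σ → Bool) (body : σ → RandProg σ) (s : σ) :
    (whileLoop cond body s).expectedCost = ⨆ k, (whileFuel cond body k s).expectedCost :=
  wp_whileLoop cond body s fun _ k => (k : ℝ≥0∞)

/-! ### Expectations determined by point masses -/

theorem ev_eq_tsum (p : RandProg α) (g : α → ℝ≥0∞) [DecidableEq α] :
    p.ev g = ∑' a, (p.ev fun b => if b = a then 1 else 0) * g a := by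
  simp only [ev, wp, ← ENNReal.tsum_mul_right]
  rw [ENNReal.tsum_comm]
  refine tsum_congr fun o => ?_
  rw [tsum_eq_single o.1]
  · simp
  · intro a ha
    simp [ha.symm]

/-- The expectation of a real function is computed by those of its positive and negative parts. -/
theorem hasExpectation_of_ev (p : RandProg α) (f : α → ℝ)
    (h1 : (p.ev fun a => ENNReal.ofReal (f a)) ≠ ∞)
    (h2 : (p.ev fun a => ENNReal.ofReal (-f a)) ≠ ∞) :
    p.HasExpectation f ((p.ev fun a => ENNReal.ofReal (f a)).toReal -
      (p.ev fun a => ENNReal.ofReal (-f a)).toReal) := by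
  have key : ∀ g : α → ℝ≥0∞, p.ev g ≠ ∞ →
      HasSum (fun o : α × ℕ => (p o).toReal * (g o.1).toReal) (p.ev g).toReal := by
    intro g hg
    have h := ENNReal.hasSum_toReal hg
    rw [← ENNReal.tsum_toReal_eq (ENNReal.ne_top_of_tsum_ne_top hg)] at h
    simp only [ENNReal.toReal_mul] at h
    exact h
  have h := (key _ h1).sub (key _ h2)
  unfold HasExpectation
  rw [show (fun o : α × ℕ => (p o).toReal * f o.1) = _ from funext fun o => ?_]
  · exact h
  rw [← mul_sub, ENNReal.toReal_ofReal', ENNReal.toReal_ofReal', max_zero_sub_max_neg_zero_eq_self]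

/-! ### Coupled programs -/

/-- Two programs have equal laws up to the relation `R` between their results. -/
def Coupled (R : α → β → Prop) (p : RandProg α) (q : RandProg β) : Prop :=
  ∀ g g', (∀ a b, R a b → ∀ k, g a k = g' b k) → p.wp g = q.wp g'

theorem Coupled.mono {R R' : α → β → Prop} {p : RandProg α} {q : RandProg β}
    (h : Coupled R p q) (hR : ∀ a b, R a b → R' a b) : Coupled R' p q :=
  fun g g' hg => h g g' fun a b hab => hg a b (hR a b hab)

theorem Coupled.pure {R : α → β → Prop} {a : α} {b : β} (h : R a b) :
    Coupled R (Pure.pure a : RandProg α) (Pure.pure b : RandProg β) := fun g g' hg => by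
  rw [wp_pure, wp_pure, hg a b h]

theorem Coupled.refl (p : RandProg α) : Coupled Eq p p := fun g g' hg => by
  have : g = g' := funext fun a => funext fun k => hg a a rfl k
  rw [this]

theorem Coupled.bind {α' β' : Type} {R : α → β → Prop} {R' : α' → β' → Prop} {p : RandProg α}
    {q : RandProg β} {f : α → RandProg α'} {f' : β → RandProg β'} (h : Coupled R p q)
    (hf : ∀ a b, R a b → Coupled R' (f a) (f' b)) : Coupled R' (p >>= f) (q >>= f') :=
  fun g g' hg => by
    rw [wp_bind, wp_bind]
    exact h _ _ fun a b hab k => hf a b hab _ _ fun a' b' hab' l => hg a' b' hab' _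

/-- `R` serves as a loop invariant. Induction on the fuel gives equality for all cut-off loops, and
the supremum preserves it; the failed test is kept as information about the final states. -/
theorem Coupled.whileLoop {R : σ → σ → Prop} {cond : σ → Bool} {body : σ → RandProg σ}
    (hc : ∀ s t, R s t → cond s = cond t)
    (hb : ∀ s t, R s t → cond s = true → Coupled R (body s) (body t)) {s t : σ} (h : R s t) :
    Coupled (fun a b => R a b ∧ cond a = false) (whileLoop cond body s) (whileLoop cond body t) := by
  have key : ∀ k s t, R s t → Coupled (fun a b => R a b ∧ cond a = false)
      (whileFuel cond body k s) (whileFuel cond body k t) := by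
    intro k
    induction k with
    | zero =>
      intro s t _ g g' _
      rw [wp_whileFuel_zero, wp_whileFuel_zero]
    | succ k ih =>
      intro s t hst g g' hg
      rw [wp_whileFuel_succ, wp_whileFuel_succ, ← hc s t hst]
      split_ifs with hcs
      · exact hb s t hst hcs _ _ fun a b hab c => ih a b hab _ _ fun a' b' h' l => hg a' b' h' _
      · exact hg s t ⟨hst, by simpa using hcs⟩ 1
  intro g g' hg
  rw [wp_whileLoop, wp_whileLoop]
  exact iSup_congr fun k => key k s t h g g' hg

end RandProg

/-! ### Pointer maps

A map `f : α → Option α` is read as a set of pointers: `f a = some b` is the arc `a → b`, and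
`f a = none` says that `a` is a root. -/

namespace PointerMap

variable {α : Type*}

/-- `r` is the root at which the pointers starting from `a` end. -/
inductive RootOf (f : α → Option α) : α → α → Prop
  | root {a : α} : f a = none → RootOf f a a
  | step {a b r : α} : f a = some b → RootOf f b r → RootOf f a r

/-- The pointers starting from `a` pass through `b`. -/
def Leads (f : α → Option α) : α → α → Prop :=
  Relation.ReflTransGen fun a b => f a = some b

/-- All pointers end at a root. -/
def Acyclic (f : α → Option α) : Prop := ∀ a, ∃ r, RootOf f a r

/-- The nodes met by following the pointers from the nodes in `S`. -/
def Reached (f : α → Option α) (S : Set α) : Set α := {x | ∃ j ∈ S, Leads f j x}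

/-- The pointers of `f` and `f'` starting from a node coincide until they meet `u`. -/
inductive CommonPath (f f' : α → Option α) (u : α) : α → Prop
  | refl : CommonPath f f' u u
  | step {a b : α} : a ≠ u → f a = some b → f' a = some b → CommonPath f f' u b →
      CommonPath f f' u a

/-- The pointers starting from a node meet `u`, and do not meet `A` before. -/
inductive PathAvoiding (A : Set α) (f : α → Option α) (u : α) : α → Prop
  | refl : PathAvoiding A f u u
  | step {a b : α} : a ≠ u → a ∉ A → f a = some b → PathAvoiding A f u b → PathAvoiding A f u a

theorem RootOf.eq_none {f : α → Option α} {a r : α} (h : RootOf f a r) : f r = none := by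
  induction h with
  | root h => exact h
  | step _ _ ih => exact ih

theorem RootOf.leads {f : α → Option α} {a r : α} (h : RootOf f a r) : Leads f a r := by
  induction h with
  | root h => exact .refl
  | step h _ ih => exact .head h ih

theorem RootOf.of_leads {f : α → Option α} {a b r : α} (hab : Leads f a b) (h : RootOf f b r) :
    RootOf f a r := by
  induction hab using Relation.ReflTransGen.head_induction_on with
  | refl => exact h
  | head h1 _ ih => exact .step h1 ih

theorem RootOf.next {f : α → Option α} {a b r : α} (h : RootOf f a r) (hb : f a = some b) :
    RootOf f b r := by
  cases h with
  | root h => simp [h] at hb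
  | step h1 h2 =>
    rw [h1, Option.some.injEq] at hb
    exact hb ▸ h2

theorem RootOf.of_leads_left {f : α → Option α} {a b r : α} (h : RootOf f a r)
    (hab : Leads f a b) : RootOf f b r := by
  induction hab using Relation.ReflTransGen.head_induction_on with
  | refl => exact h
  | head h1 _ ih => exact ih (h.next h1)

theorem RootOf.unique {f : α → Option α} {a r r' : α} (h : RootOf f a r) (h' : RootOf f a r') :
    r = r' := by
  induction h with
  | root h =>
    cases h' with
    | root _ => rfl
    | step h1 _ => simp [h] at h1
  | step h _ ih => exact ih (h'.next h)

/-- Following one pointer from a node on a cycle stays on that cycle, while a root has no pointer.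
-/
theorem RootOf.not_transGen {f : α → Option α} {a r : α} (h : RootOf f a r) :
    ¬ Relation.TransGen (fun a b => f a = some b) a a := by
  induction h with
  | root h =>
    intro ht
    obtain ⟨b, hb, _⟩ := Relation.TransGen.head'_iff.1 ht
    simp [h] at hb
  | step h _ ih =>
    intro ht
    obtain ⟨b, hb, hba⟩ := Relation.TransGen.head'_iff.1 ht
    rw [h, Option.some.injEq] at hb
    subst hb
    exact ih (.tail' hba h)

theorem Acyclic.not_leads {f : α → Option α} (hf : Acyclic f) {a b : α} (h : f a = some b) :
    ¬ Leads f b a := fun hl =>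
  (hf a).choose_spec.not_transGen (.head' h hl)

theorem Leads.congr {f f' : α → Option α} {a b : α} (hab : Leads f a b)
    (h : ∀ x, Leads f a x → f' x = f x) : Leads f' a b := by
  induction hab using Relation.ReflTransGen.head_induction_on with
  | refl => exact .refl
  | @head a c h1 _ ih =>
    exact .head ((h a .refl).trans h1) (ih fun x hx => h x (.head h1 hx))

theorem RootOf.congr {f f' : α → Option α} {a r : α} (har : RootOf f a r)
    (h : ∀ x, Leads f a x → f' x = f x) : RootOf f' a r :=
  .of_leads (har.leads.congr h) (.root ((h r har.leads).trans har.eq_none))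

theorem leads_total {f : α → Option α} {a b c : α} (hb : Leads f a b) (hc : Leads f a c) :
    Leads f b c ∨ Leads f c b :=
  Relation.ReflTransGen.total_of_right_unique
    (fun _ _ _ h h' => Option.some.inj (h.symm.trans h')) hb hc

theorem Leads.eq_of_none {f : α → Option α} {a b : α} (h : Leads f a b) (ha : f a = none) :
    a = b := by
  rcases h.cases_head with h | ⟨c, hc, _⟩
  · exact h
  · simp [ha] at hc

theorem PathAvoiding.leads {A : Set α} {f : α → Option α} {u a : α} (h : PathAvoiding A f u a) :
    Leads f a u := by
  induction h with
  | refl => exact .refl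
  | step _ _ h _ ih => exact .head h ih

theorem PathAvoiding.congr {A : Set α} {f f' : α → Option α} {u a : α}
    (h : PathAvoiding A f u a) (hf : ∀ x, x ≠ u → f' x = f x) : PathAvoiding A f' u a := by
  induction h with
  | refl => exact .refl
  | step h1 h2 h3 _ ih => exact .step h1 h2 ((hf _ h1).trans h3) ih

/-- This is loop erasure: if `v` already lies on the path, the path is cut there; otherwise the
pointer from `u` to `v` is appended. -/
theorem PathAvoiding.extend {A : Set α} {f : α → Option α} {u v a : α}
    (h : PathAvoiding A f u a) (hu : u ∉ A) (huv : f u = some v) : PathAvoiding A f v a := by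
  induction h with
  | refl =>
    by_cases h : u = v
    · exact h ▸ .refl
    · exact .step h hu huv .refl
  | @step a b h1 h2 h3 _ ih =>
    by_cases h : a = v
    · exact h ▸ .refl
    · exact .step h h2 h3 ih

/-- At most one node ends a path avoiding `A`, if paths end at roots and at nodes of `A`. -/
theorem PathAvoiding.end_unique {A : Set α} {f : α → Option α} {u u' a : α}
    (h : PathAvoiding A f u a) (h' : PathAvoiding A f u' a) (hu : u ∈ A ∨ f u = none)
    (hu' : u' ∈ A ∨ f u' = none) : u = u' := by
  induction h with
  | refl =>
    cases h' with
    | refl => rfl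
    | step _ h2 h3 _ =>
      rcases hu with hu | hu
      · exact absurd hu h2
      · simp [hu] at h3
  | @step a b h1 h2 h3 _ ih =>
    cases h' with
    | refl =>
      rcases hu' with hu | hu
      · exact absurd hu h2
      · simp [hu] at h3
    | step _ _ h3' h4 =>
      rw [h3, Option.some.injEq] at h3'
      exact ih (h3' ▸ h4)

theorem exists_pathAvoiding {A : Set α} {f : α → Option α} {a r : α} (h : RootOf f a r) :
    ∃ u, PathAvoiding A f u a ∧ (u ∈ A ∨ f u = none) := by
  induction h with
  | @root a h => exact ⟨a, .refl, .inr h⟩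
  | @step a b r h _ ih =>
    by_cases ha : a ∈ A
    · exact ⟨a, .refl, .inl ha⟩
    · obtain ⟨u, hu, hu'⟩ := ih
      by_cases hau : a = u
      · exact ⟨a, .refl, hau ▸ hu'⟩
      · exact ⟨u, .step hau ha h hu, hu'⟩

theorem subset_reached (f : α → Option α) (S : Set α) : S ⊆ Reached f S :=
  fun j hj => ⟨j, hj, .refl⟩

theorem Leads.mem_reached {f : α → Option α} {S : Set α} {a b : α} (h : Leads f a b)
    (ha : a ∈ Reached f S) : b ∈ Reached f S := by
  obtain ⟨j, hj, hja⟩ := ha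
  exact ⟨j, hj, hja.trans h⟩

theorem mem_reached_insert {f : α → Option α} {S : Set α} {i x : α} :
    x ∈ Reached f (insert i S) ↔ x ∈ Reached f S ∨ Leads f i x := by
  simp [Reached, or_comm]

theorem reached_empty (f : α → Option α) : Reached f ∅ = ∅ := by
  ext x
  simp [Reached]

/-! ### Changing the pointer of one node -/

variable [DecidableEq α]

/-- Loop erasure in two maps at once. The nodes before `u` on the common path differ from `u`, so
their pointers survive the update. -/
theorem CommonPath.extend {f f' : α → Option α} {u v a : α} (h : CommonPath f f' u a) :
    CommonPath (Function.update f u (some v)) (Function.update f' u (some v)) v a := by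
  induction h with
  | refl =>
    by_cases h : u = v
    · exact h ▸ .refl
    · exact .step h (by simp) (by simp) .refl
  | @step a b h1 h2 h3 _ ih =>
    by_cases h : a = v
    · exact h ▸ .refl
    · exact .step h (by simp [h1, h2]) (by simp [h1, h3]) ih

theorem CommonPath.update {f f' : α → Option α} {u a : α} (h : CommonPath f f' u a)
    (c : Option α) : CommonPath (Function.update f u c) (Function.update f' u c) u a := by
  induction h with
  | refl => exact .refl
  | step h1 h2 h3 _ ih => exact .step h1 (by simp [h1, h2]) (by simp [h1, h3]) ih

/-- Pointers followed from `S` never arrive at `u`, so the pointer of `u` is never used. -/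
theorem reached_update {f : α → Option α} {S : Set α} {u : α} (hu : u ∉ Reached f S)
    (c : Option α) : Reached (Function.update f u c) S = Reached f S := by
  have key : ∀ j ∈ S, ∀ x, Leads f j x → Function.update f u c x = f x := by
    intro j hj x hx
    refine Function.update_of_ne ?_ _ _
    rintro rfl
    exact hu ⟨j, hj, hx⟩
  ext x
  constructor
  · rintro ⟨j, hj, hx⟩
    induction hx with
    | refl => exact subset_reached f S hj
    | @tail b d _ h ih =>
      have hb : b ≠ u := by
        rintro rfl
        exact hu ih
      rw [Function.update_of_ne hb] at h
      exact Leads.mem_reached (.single h) ih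
  · rintro ⟨j, hj, hx⟩
    exact ⟨j, hj, hx.congr (key j hj)⟩

theorem Acyclic.update_none {f : α → Option α} (hf : Acyclic f) (u : α) :
    Acyclic (Function.update f u none) := by
  intro a
  obtain ⟨r, hr⟩ := hf a
  induction hr with
  | @root a h => exact ⟨a, .root (by by_cases h' : a = u <;> simp [h', h])⟩
  | @step a b r h _ ih =>
    by_cases h' : a = u
    · exact ⟨a, .root (by simp [h'])⟩
    · obtain ⟨r', hr'⟩ := ih
      exact ⟨r', .step (by simp [h', h]) hr'⟩

/-- If cutting the pointer of `u` destroys all cycles, so does cutting that of the next node. -/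
theorem Acyclic.cut_next {f : α → Option α} {u v : α} (hf : Acyclic (Function.update f u none))
    (huv : f u = some v) : Acyclic (Function.update f v none) := by
  have hv : ∃ r, RootOf (Function.update f v none) v r := ⟨v, .root (by simp)⟩
  intro a
  obtain ⟨r, hr⟩ := hf a
  induction hr with
  | @root a h =>
    by_cases hav : a = v
    · exact hav ▸ hv
    -- The cut at `u` is removed: a path that ended there now continues to `v`, where the new cut
    -- stops it.
    by_cases hau : a = u
    · subst hau
      exact ⟨v, .step (by rw [Function.update_of_ne hav, huv]) (.root (by simp))⟩
    · rw [Function.update_of_ne hau] at h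
      exact ⟨a, .root (by rw [Function.update_of_ne hav, h])⟩
  | @step a b r h _ ih =>
    by_cases hav : a = v
    · exact hav ▸ hv
    by_cases hau : a = u
    · simp [hau] at h
    · rw [Function.update_of_ne hau] at h
      obtain ⟨r', hr'⟩ := ih
      exact ⟨r', .step (by rw [Function.update_of_ne hav, h]) hr'⟩

/-- A new cycle would have to use the new pointer from `i` to `k`, and so return from `k` to `i`
along `f`. -/
theorem Acyclic.update_some {f : α → Option α} (hf : Acyclic f) {i k : α} (h : ¬ Leads f k i) :
    Acyclic (Function.update f i (some k)) := by
  have hk : ∃ r, RootOf (Function.update f i (some k)) k r := by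
    obtain ⟨r, hr⟩ := hf k
    refine ⟨r, hr.congr fun x hx => Function.update_of_ne ?_ _ _⟩
    rintro rfl
    exact h hx
  have hi : ∃ r, RootOf (Function.update f i (some k)) i r := by
    obtain ⟨r, hr⟩ := hk
    exact ⟨r, .step (by simp) hr⟩
  intro a
  obtain ⟨r, hr⟩ := hf a
  induction hr with
  | @root a h =>
    by_cases hai : a = i
    · exact hai ▸ hi
    · exact ⟨a, .root (by rw [Function.update_of_ne hai, h])⟩
  | @step a b r h _ ih =>
    by_cases hai : a = i
    · exact hai ▸ hi
    · obtain ⟨r', hr'⟩ := ih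
      exact ⟨r', .step (by rw [Function.update_of_ne hai, h]) hr'⟩

/-- If the pointer into `v` of a node outside a closed set containing `v` is the only one on
cycles, there are no cycles. -/
theorem Acyclic.of_cut {f : α → Option α} {S : Set α} {u v : α}
    (hf : Acyclic (Function.update f u none)) (hu : u ∉ Reached f S) (hv : v ∈ Reached f S)
    (huv : f u = some v) : Acyclic f := by
  have h := hf.update_some (i := u) (k := v) ?_
  · rwa [Function.update_idem, ← huv, Function.update_eq_self] at h
  · intro hl
    have h := reached_update hu none
    exact hu (h ▸ hl.mem_reached (h.symm ▸ hv))

/-- In the acyclic updated map the pointers from `k` never return to `i`, so the changed pointer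
does not matter. For the converse, the root of `k` in the updated map is also its root in `f`, and
roots are unique. -/
theorem rootOf_update_iff {f : α → Option α} {i k j : α}
    (hf' : Acyclic (Function.update f i (some k))) :
    RootOf (Function.update f i (some k)) k j ↔ RootOf f k j := by
  have h : ∀ x, Leads (Function.update f i (some k)) k x →
      f x = Function.update f i (some k) x := by
    intro x hx
    refine (Function.update_of_ne ?_ _ _).symm
    rintro rfl
    exact hf'.not_leads (by simp) hx
  refine ⟨fun hr => hr.congr h, fun hr => ?_⟩
  obtain ⟨r, hr'⟩ := hf' k
  rwa [hr.unique (hr'.congr h)]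

/-- The path is stopped at the first of `b` and `c` that it meets; before that, neither of the two
cut pointers is used. -/
theorem Leads.exists_first {f : α → Option α} {a b : α} (h : Leads f a b) (c : α) :
    ∃ d, (d = b ∨ d = c) ∧
      Leads (Function.update (Function.update f b none) c none) a d := by
  induction h using Relation.ReflTransGen.head_induction_on with
  | refl => exact ⟨b, .inl rfl, .refl⟩
  | @head a x h1 _ ih =>
    by_cases hb : a = b
    · exact ⟨a, .inl hb, .refl⟩
    by_cases hc : a = c
    · exact ⟨a, .inr hc, .refl⟩
    obtain ⟨d, hd, hl⟩ := ih
    exact ⟨d, hd, .head (by simp [hb, hc, h1]) hl⟩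

theorem Leads.of_update_none {f : α → Option α} {a b c : α}
    (h : Leads (Function.update f c none) a b) : Leads f a b := by
  refine Relation.ReflTransGen.mono ?_ _ _ h
  intro x y hxy
  by_cases hx : x = c
  · simp [hx] at hxy
  · rwa [Function.update_of_ne hx] at hxy

/-- A walk state determines the preceding one. -/
theorem eq_of_next_eq {f : α → Option α} {i u u' v : α}
    (hu : Acyclic (Function.update f u none)) (hu' : Acyclic (Function.update f u' none))
    (hi : Leads f i u) (hi' : Leads f i u') (hv : f u = some v) (hv' : f u' = some v) :
    u = u' := by
  by_contra hne
  wlog h : Leads f u u' generalizing u u'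
  · exact this hu' hu hi' hi hv' hv (Ne.symm hne) ((leads_total hi hi').resolve_left h)
  have hl : Leads f v u' := by
    rcases h.cases_head with h | ⟨c, hc, hl⟩
    · exact absurd h hne
    · rw [hv, Option.some.injEq] at hc
      exact hc ▸ hl
  -- From `v`, stop at the first of `u'` and `u`. If it is `u'`, there is a cycle through `u'` that
  -- avoids the pointer of `u`, contrary to `hu`; if it is `u`, there is one through `u` that avoids
  -- the pointer of `u'`, contrary to `hu'`.
  obtain ⟨d, rfl | rfl, hd⟩ := hl.exists_first u
  · rw [Function.update_comm (Ne.symm hne)] at hd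
    exact hu.not_leads (by rw [Function.update_of_ne (Ne.symm hne), hv']) hd.of_update_none
  · exact hu'.not_leads (by rw [Function.update_of_ne hne, hv]) hd.of_update_none

end PointerMap

/-! ### In-forests as acyclic pointer maps -/

namespace WeightedDigraph

open PointerMap

variable {n : ℕ}

/-- The set of arcs given by a pointer map. -/
def pointerArcs (f : Fin n → Option (Fin n)) : Finset (Fin n × Fin n) :=
  Finset.univ.filter fun e => f e.1 = some e.2

theorem mem_pointerArcs {f : Fin n → Option (Fin n)} {e : Fin n × Fin n} :
    e ∈ pointerArcs f ↔ f e.1 = some e.2 := by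
  simp [pointerArcs]

theorem pointerArcs_injective :
    Function.Injective (pointerArcs : (Fin n → Option (Fin n)) → Finset (Fin n × Fin n)) := by
  intro f g h
  funext a
  refine Option.ext fun b => ?_
  have := congrArg (fun F => (a, b) ∈ F) h
  simpa [mem_pointerArcs] using this

theorem outCount_pointerArcs (f : Fin n → Option (Fin n)) (v : Fin n) :
    outCount (pointerArcs f) v = if f v = none then 0 else 1 := by
  unfold outCount
  split_ifs with h
  · rw [Finset.card_eq_zero, Finset.filter_eq_empty_iff]
    rintro e he rfl
    rw [mem_pointerArcs, h] at he
    cases he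
  · obtain ⟨b, hb⟩ := Option.ne_none_iff_exists'.1 h
    rw [Finset.card_eq_one]
    refine ⟨(v, b), ?_⟩
    ext ⟨x, y⟩
    simp only [Finset.mem_filter, mem_pointerArcs, Finset.mem_singleton, Prod.mk.injEq]
    constructor
    · rintro ⟨h1, rfl⟩
      rw [hb, Option.some.injEq] at h1
      exact ⟨rfl, h1.symm⟩
    · rintro ⟨rfl, rfl⟩
      exact ⟨hb, rfl⟩

/-- Both ends of an arc have the same root, so the root is an invariant of weakly connected
components. -/
theorem SameComponent.rootOf_iff {f : Fin n → Option (Fin n)} {i j r : Fin n}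
    (h : SameComponent (pointerArcs f) i j) : RootOf f i r ↔ RootOf f j r := by
  induction h with
  | rel a b h => exact ⟨fun hr => hr.next (mem_pointerArcs.1 h), .step (mem_pointerArcs.1 h)⟩
  | refl a => rfl
  | symm a b _ ih => exact ih.symm
  | trans a b c _ _ ih1 ih2 => exact ih1.trans ih2

theorem sameComponent_of_leads {f : Fin n → Option (Fin n)} {i j : Fin n} (h : Leads f i j) :
    SameComponent (pointerArcs f) i j := by
  induction h with
  | refl => exact .refl _
  | tail _ h ih => exact .trans _ _ _ ih (.rel _ _ (mem_pointerArcs.2 h))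

theorem rootOf_iff_sameComponent {f : Fin n → Option (Fin n)} {i j : Fin n} :
    RootOf f i j ↔ SameComponent (pointerArcs f) i j ∧ outCount (pointerArcs f) j = 0 := by
  rw [outCount_pointerArcs]
  constructor
  · intro h
    exact ⟨sameComponent_of_leads h.leads, if_pos h.eq_none⟩
  · rintro ⟨h1, h2⟩
    exact h1.rootOf_iff.2 (.root (by simpa using h2))

/-- Out-degrees are at most one for a pointer map, so only the roots are at issue. A node of
out-degree zero in the component of `i` is the root of `i`, and by uniqueness of roots there cannot
be two. -/
theorem isInForest_pointerArcs (G : WeightedDigraph n) {f : Fin n → Option (Fin n)} :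
    G.IsInForest (pointerArcs f) ↔ pointerArcs f ⊆ G.arcs ∧ Acyclic f := by
  refine and_congr_right fun _ => ?_
  constructor
  · intro h i
    obtain ⟨r, h1, h2, _⟩ := h i
    exact ⟨r, rootOf_iff_sameComponent.2 ⟨h1, h2⟩⟩
  · intro h i
    obtain ⟨r, hr⟩ := h i
    obtain ⟨h1, h2⟩ := rootOf_iff_sameComponent.1 hr
    refine ⟨r, h1, h2, fun v hv hvr => ?_⟩
    rw [outCount_pointerArcs, if_neg]
    intro hn
    exact hvr ((hv.rootOf_iff.2 (.root hn)).unique hr)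

/-- All out-degrees of an in-forest are at most one, so its arcs are the graph of a partial
function. -/
theorem IsInForest.exists_pointerArcs {G : WeightedDigraph n} {F : Finset (Fin n × Fin n)}
    (h : G.IsInForest F) : ∃ f, pointerArcs f = F := by
  classical
  have hle : ∀ v, outCount F v ≤ 1 := by
    intro v
    obtain ⟨r, _, h2, h3⟩ := h.2 v
    by_cases hv : v = r
    · rw [hv, h2]
      exact zero_le_one
    · exact (h3 v (.refl _) hv).le
  refine ⟨fun v => if hv : ∃ b, (v, b) ∈ F then some hv.choose else none, ?_⟩
  ext ⟨v, b⟩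
  rw [mem_pointerArcs]
  constructor
  · intro h1
    by_cases hv : ∃ b, (v, b) ∈ F
    · simp only [dif_pos hv, Option.some.injEq] at h1
      exact h1 ▸ hv.choose_spec
    · simp [dif_neg hv] at h1
  · intro h1
    have hv : ∃ b, (v, b) ∈ F := ⟨b, h1⟩
    simp only [dif_pos hv, Option.some.injEq]
    have := Finset.card_le_one.1 (hle v) (v, hv.choose)
      (Finset.mem_filter.2 ⟨hv.choose_spec, rfl⟩) (v, b) (Finset.mem_filter.2 ⟨h1, rfl⟩)
    exact (Prod.mk.inj this).2

theorem pointerArcs_mem_inForests (G : WeightedDigraph n) {f : Fin n → Option (Fin n)} :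
    pointerArcs f ∈ G.inForests ↔ pointerArcs f ⊆ G.arcs ∧ Acyclic f := by
  classical
  simp only [inForests, Finset.mem_filter, Finset.mem_powerset, isInForest_pointerArcs]
  tauto

theorem pointerArcs_mem_inForestsRootedAt (G : WeightedDigraph n) {f : Fin n → Option (Fin n)}
    {i j : Fin n} : pointerArcs f ∈ G.inForestsRootedAt i j ↔
      (pointerArcs f ⊆ G.arcs ∧ Acyclic f) ∧ RootOf f i j := by
  classical
  simp only [inForestsRootedAt, Finset.mem_filter, pointerArcs_mem_inForests, rootOf_iff_sameComponent]

end WeightedDigraph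

namespace WeightedDigraph

open PointerMap

variable {n : ℕ}

/-! ### The forest law on pointer maps -/

/-- The weight of the choice `c` for the pointer of `u`. -/
def pointerWeight (G : WeightedDigraph n) (u : Fin n) (c : Option (Fin n)) : ℝ := c.elim 1 (G.w u)

/-- The weight of a pointer map. -/
def mapWeight (G : WeightedDigraph n) (f : Fin n → Option (Fin n)) : ℝ :=
  ∏ a, G.pointerWeight a (f a)

open scoped Classical in
/-- The total weight of the acyclic pointer maps. -/
noncomputable def partitionFunction (G : WeightedDigraph n) : ℝ :=
  ∑ f with Acyclic f, G.mapWeight f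

/-- The normalized weight of a pointer map. -/
noncomputable def density (G : WeightedDigraph n) (f : Fin n → Option (Fin n)) : ℝ :=
  G.mapWeight f / G.partitionFunction

theorem pointerWeight_nonneg (G : WeightedDigraph n) (u : Fin n) (c : Option (Fin n)) :
    0 ≤ G.pointerWeight u c := by
  cases c with
  | none => exact zero_le_one
  | some v => exact G.w_nonneg u v

theorem deg_nonneg (G : WeightedDigraph n) (u : Fin n) : 0 ≤ G.deg u :=
  Finset.sum_nonneg fun v _ => G.w_nonneg u v

theorem one_add_deg_pos (G : WeightedDigraph n) (u : Fin n) : 0 < 1 + G.deg u := by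
  linarith [G.deg_nonneg u]

theorem sum_pointerWeight (G : WeightedDigraph n) (u : Fin n) :
    ∑ c, G.pointerWeight u c = 1 + G.deg u :=
  Fintype.sum_option _

theorem mapWeight_nonneg (G : WeightedDigraph n) (f : Fin n → Option (Fin n)) :
    0 ≤ G.mapWeight f :=
  Finset.prod_nonneg fun _ _ => G.pointerWeight_nonneg _ _

theorem acyclic_none {α : Type*} : Acyclic (fun _ : α => (none : Option α)) :=
  fun a => ⟨a, .root rfl⟩

theorem partitionFunction_pos (G : WeightedDigraph n) : 0 < G.partitionFunction := by
  classical
  refine lt_of_lt_of_le ?_ (Finset.single_le_sum (fun f _ => G.mapWeight_nonneg f)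
    (Finset.mem_filter.2 ⟨Finset.mem_univ _, acyclic_none⟩))
  simp [mapWeight, pointerWeight]

theorem density_nonneg (G : WeightedDigraph n) (f : Fin n → Option (Fin n)) : 0 ≤ G.density f :=
  div_nonneg (G.mapWeight_nonneg f) G.partitionFunction_pos.le

/-- Both sides are the product over the nodes other than `u`, times the weights of the two choices
for `u`. This detailed balance underlies both the matrix forest theorem and the analysis of the
walk. -/
theorem mapWeight_mul_pointerWeight (G : WeightedDigraph n) (f : Fin n → Option (Fin n))
    (u : Fin n) (c : Option (Fin n)) : G.mapWeight f * G.pointerWeight u c =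
      G.mapWeight (Function.update f u c) * G.pointerWeight u (f u) := by
  unfold mapWeight
  rw [← Finset.mul_prod_erase _ _ (Finset.mem_univ u),
    ← Finset.mul_prod_erase Finset.univ (fun a => G.pointerWeight a (Function.update f u c a))
      (Finset.mem_univ u), Function.update_self,
    Finset.prod_congr rfl fun a ha => by rw [← Function.update_of_ne (Finset.ne_of_mem_erase ha) c f]]
  ring

theorem density_mul_pointerWeight (G : WeightedDigraph n) (f : Fin n → Option (Fin n))
    (u : Fin n) (c : Option (Fin n)) : G.density f * G.pointerWeight u c =
      G.density (Function.update f u c) * G.pointerWeight u (f u) := by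
  unfold density
  rw [div_mul_eq_mul_div, mapWeight_mul_pointerWeight, div_mul_eq_mul_div]

/-- Exchanging the pointer of `u` with another choice for it does not change sums. -/
theorem sum_swap_pointer {M : Type*} [AddCommMonoid M] (u : Fin n)
    (Ψ : (Fin n → Option (Fin n)) → Option (Fin n) → M) :
    ∑ f, ∑ c, Ψ f c = ∑ f : Fin n → Option (Fin n), ∑ c, Ψ (Function.update f u c) (f u) := by
  rw [← Fintype.sum_prod_type', ← Fintype.sum_prod_type'
    (f := fun f c => Ψ (Function.update f u c) (f u))]
  have hinv : Function.Involutive fun p : (Fin n → Option (Fin n)) × Option (Fin n) =>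
      (Function.update p.1 u p.2, p.1 u) := by
    rintro ⟨f, c⟩
    simp
  exact (Equiv.sum_comp hinv.toPerm fun p : (Fin n → Option (Fin n)) × Option (Fin n) =>
    Ψ p.1 p.2).symm

theorem forestWeight_pointerArcs (G : WeightedDigraph n) (f : Fin n → Option (Fin n)) :
    G.forestWeight (pointerArcs f) = G.mapWeight f := by
  unfold forestWeight mapWeight pointerArcs
  rw [Finset.prod_filter, ← Finset.univ_product_univ, Finset.prod_product]
  refine Finset.prod_congr rfl fun a _ => ?_
  cases h : f a with
  | none => simp [pointerWeight, h]
  | some b => simp [pointerWeight, h]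

/-- Pointers off the arcs carry weight zero, so sums may run over all acyclic maps without
mentioning the arcs. -/
theorem mapWeight_eq_zero (G : WeightedDigraph n) {f : Fin n → Option (Fin n)}
    (h : ¬ pointerArcs f ⊆ G.arcs) : G.mapWeight f = 0 := by
  obtain ⟨⟨a, b⟩, he, hn⟩ := Finset.not_subset.1 h
  rw [mem_pointerArcs] at he
  refine Finset.prod_eq_zero (Finset.mem_univ a) ?_
  dsimp only at he
  rw [he]
  exact G.w_eq_zero a b hn

open scoped Classical in
theorem forestMass_pointerArcs (G : WeightedDigraph n) (f : Fin n → Option (Fin n)) :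
    G.forestMass (pointerArcs f) = if Acyclic f then ENNReal.ofReal (G.mapWeight f) else 0 := by
  unfold forestMass
  simp only [pointerArcs_mem_inForests, forestWeight_pointerArcs]
  by_cases h : pointerArcs f ⊆ G.arcs
  · simp [h]
  · simp [h, G.mapWeight_eq_zero h]

theorem sum_eq_sum_pointerArcs {M : Type*} [AddCommMonoid M]
    (Ψ : Finset (Fin n × Fin n) → M) (h : ∀ F, Ψ F ≠ 0 → ∃ f, pointerArcs f = F) :
    ∑ F, Ψ F = ∑ f, Ψ (pointerArcs f) := by
  classical
  rw [← Finset.sum_image (g := pointerArcs) (f := Ψ) pointerArcs_injective.injOn]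
  refine (Finset.sum_subset (Finset.subset_univ _) fun F _ hF => ?_).symm
  by_contra hne
  obtain ⟨f, rfl⟩ := h F hne
  exact hF (Finset.mem_image_of_mem _ (Finset.mem_univ _))

theorem exists_pointerArcs_of_forestMass_ne_zero (G : WeightedDigraph n)
    {F : Finset (Fin n × Fin n)} (h : G.forestMass F ≠ 0) : ∃ f, pointerArcs f = F := by
  classical
  unfold forestMass at h
  have hF : F ∈ G.inForests := by
    by_contra hF
    exact h (if_neg hF)
  simp only [inForests, Finset.mem_filter] at hF
  exact hF.2.exists_pointerArcs

theorem tsum_forestMass (G : WeightedDigraph n) :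
    ∑' F, G.forestMass F = ENNReal.ofReal G.partitionFunction := by
  classical
  rw [tsum_fintype, sum_eq_sum_pointerArcs _ fun F => G.exists_pointerArcs_of_forestMass_ne_zero,
    partitionFunction, ENNReal.ofReal_sum_of_nonneg fun f _ => G.mapWeight_nonneg f,
    Finset.sum_filter]
  exact Finset.sum_congr rfl fun f _ => G.forestMass_pointerArcs f

theorem forestPMF_apply (G : WeightedDigraph n) (F : Finset (Fin n × Fin n)) :
    G.forestPMF F = G.forestMass F * (ENNReal.ofReal G.partitionFunction)⁻¹ := by
  rw [forestPMF, PMF.normalize_apply, tsum_forestMass]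

theorem exists_pointerArcs_of_forestPMF_ne_zero (G : WeightedDigraph n)
    {F : Finset (Fin n × Fin n)} (h : G.forestPMF F ≠ 0) : ∃ f, pointerArcs f = F := by
  rw [forestPMF_apply] at h
  exact G.exists_pointerArcs_of_forestMass_ne_zero (left_ne_zero_of_mul h)

open scoped Classical in
theorem forestPMF_pointerArcs (G : WeightedDigraph n) (f : Fin n → Option (Fin n)) :
    G.forestPMF (pointerArcs f) = if Acyclic f then ENNReal.ofReal (G.density f) else 0 := by
  rw [forestPMF_apply, forestMass_pointerArcs, ite_mul, zero_mul, density,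
    ENNReal.ofReal_div_of_pos G.partitionFunction_pos, ENNReal.div_eq_inv_mul, mul_comm]

open scoped Classical in
theorem sum_density_acyclic (G : WeightedDigraph n) : ∑ f with Acyclic f, G.density f = 1 := by
  simp only [density]
  rw [← Finset.sum_div]
  exact div_self G.partitionFunction_pos.ne'

open scoped Classical in
theorem forestProb_eq_sum (G : WeightedDigraph n) (i j : Fin n) :
    G.forestProb (G.inForestsRootedAt i j) =
      ∑ f with Acyclic f, if RootOf f i j then G.density f else 0 := by
  have h : ∀ f : Fin n → Option (Fin n), (if pointerArcs f ∈ G.inForestsRootedAt i j then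
      G.forestPMF (pointerArcs f) else 0) =
      ENNReal.ofReal (if Acyclic f then if RootOf f i j then G.density f else 0 else 0) := by
    intro f
    rw [forestPMF_pointerArcs]
    simp only [pointerArcs_mem_inForestsRootedAt]
    by_cases h : pointerArcs f ⊆ G.arcs
    · by_cases h1 : Acyclic f <;> by_cases h2 : RootOf f i j <;> simp [h, h1, h2]
    · simp [h, density, G.mapWeight_eq_zero h]
  rw [forestProb, PMF.toOuterMeasure_apply_finset, ← Finset.sum_ite_mem_eq,
    sum_eq_sum_pointerArcs, Finset.sum_filter]
  · simp only [h]
    rw [← ENNReal.ofReal_sum_of_nonneg, ENNReal.toReal_ofReal]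
    · refine Finset.sum_nonneg fun f _ => ?_
      split_ifs <;> simp [density_nonneg]
    · intro f _
      split_ifs <;> simp [density_nonneg]
  · intro F hF
    refine G.exists_pointerArcs_of_forestPMF_ne_zero fun h0 => hF ?_
    simp [h0]

theorem forestProb_nonneg (G : WeightedDigraph n) (S : Finset (Finset (Fin n × Fin n))) :
    0 ≤ G.forestProb S := ENNReal.toReal_nonneg

theorem sum_forestProb (G : WeightedDigraph n) (i : Fin n) :
    ∑ j, G.forestProb (G.inForestsRootedAt i j) = 1 := by
  classical
  simp only [forestProb_eq_sum]
  rw [Finset.sum_comm, ← G.sum_density_acyclic]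
  refine Finset.sum_congr rfl fun f hf => ?_
  obtain ⟨r, hr⟩ := (Finset.mem_filter.1 hf).2 i
  rw [Finset.sum_eq_single r]
  · exact if_pos hr
  · intro j _ hj
    exact if_neg fun h => hj (h.unique hr)
  · simp

/-! ### The matrix forest theorem -/

/-- Weigh pairs of an acyclic `f` and a second choice `c` for the pointer of `i`. On the left `i`
has root `j` in `f`; on the right, `c` points to a node with root `j`, or `c = none` and `i = j`. If
exchanging `c` with `f i` keeps the map acyclic, the exchange matches the two conditions. If it
creates a cycle, then `c` leads back to `i` in `f`, so both conditions already agree. -/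
theorem one_add_deg_mul_forestProb (G : WeightedDigraph n) (i j : Fin n) :
    (1 + G.deg i) * G.forestProb (G.inForestsRootedAt i j) =
      (if i = j then 1 else 0) + ∑ k, G.w i k * G.forestProb (G.inForestsRootedAt k j) := by
  classical
  let R : (Fin n → Option (Fin n)) → Option (Fin n) → Prop :=
    fun f c => c.elim (i = j) fun k => RootOf f k j
  let Ψ₁ : (Fin n → Option (Fin n)) → Option (Fin n) → ℝ := fun f c =>
    if Acyclic f ∧ RootOf f i j then G.density f * G.pointerWeight i c else 0
  let Ψ₂ : (Fin n → Option (Fin n)) → Option (Fin n) → ℝ := fun f c =>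
    if Acyclic f ∧ R f c then G.density f * G.pointerWeight i c else 0
  have h1 : ∑ f, ∑ c, Ψ₁ f c = (1 + G.deg i) * G.forestProb (G.inForestsRootedAt i j) := by
    rw [forestProb_eq_sum, Finset.sum_filter, Finset.mul_sum]
    refine Finset.sum_congr rfl fun f _ => ?_
    rw [← sum_pointerWeight, Finset.sum_mul]
    refine Finset.sum_congr rfl fun c _ => ?_
    by_cases h : Acyclic f <;> by_cases h' : RootOf f i j <;> simp [Ψ₁, h, h', mul_comm]
  have h2 : ∑ f, ∑ c, Ψ₂ f c = (if i = j then 1 else 0) +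
      ∑ k, G.w i k * G.forestProb (G.inForestsRootedAt k j) := by
    rw [Finset.sum_comm, Fintype.sum_option]
    congr 1
    · rw [← G.sum_density_acyclic, Finset.sum_filter]
      by_cases h : i = j <;> simp [Ψ₂, R, h, pointerWeight]
    · refine Finset.sum_congr rfl fun k _ => ?_
      rw [forestProb_eq_sum, Finset.sum_filter, Finset.mul_sum]
      refine Finset.sum_congr rfl fun f _ => ?_
      by_cases h : Acyclic f <;> by_cases h' : RootOf f k j <;>
        simp [Ψ₂, R, h, h', mul_comm, pointerWeight]
  rw [← h1, ← h2]
  -- Separate the pairs whose exchange is acyclic from those whose exchange closes a cycle.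
  have split : ∀ Ψ : (Fin n → Option (Fin n)) → Option (Fin n) → ℝ, ∑ f, ∑ c, Ψ f c =
      (∑ f, ∑ c, if Acyclic (Function.update f i c) then Ψ f c else 0) +
      ∑ f, ∑ c, if Acyclic (Function.update f i c) then 0 else Ψ f c := by
    intro Ψ
    rw [← Finset.sum_add_distrib]
    refine Finset.sum_congr rfl fun f _ => ?_
    rw [← Finset.sum_add_distrib]
    exact Finset.sum_congr rfl fun c _ => by split_ifs <;> simp
  rw [split Ψ₁, split Ψ₂]
  congr 1
  -- After the exchange `i` points to `c`, so its root in the new map is the root of `c` in the old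
  -- one.
  · rw [sum_swap_pointer i]
    refine Finset.sum_congr rfl fun f _ => Finset.sum_congr rfl fun c _ => ?_
    rw [Function.update_idem, Function.update_eq_self]
    by_cases hf : Acyclic f
    · by_cases hc : Acyclic (Function.update f i c)
      · have hR : RootOf (Function.update f i c) i j ↔ R f c := by
          cases c with
          | none =>
            exact ⟨fun h => h.leads.eq_of_none (by simp),
              fun h : i = j => h ▸ .root (by simp)⟩
          | some k =>
            refine Iff.trans ?_ (rootOf_update_iff hc)
            exact ⟨fun h => h.next (by simp), .step (by simp)⟩
        simp only [Ψ₁, Ψ₂, hR, hf, hc, true_and, if_true, ← density_mul_pointerWeight]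
      · simp [hf, hc, Ψ₁]
    · simp [hf, Ψ₂]
  · refine Finset.sum_congr rfl fun f _ => Finset.sum_congr rfl fun c _ => ?_
    split_ifs with hc
    · rfl
    by_cases hf : Acyclic f
    · cases c with
      | none => exact absurd (hf.update_none i) hc
      | some k =>
        have hl : Leads f k i := by
          by_contra hl
          exact hc (hf.update_some hl)
        have hR : RootOf f i j ↔ R f (some k) :=
          ⟨fun h => .of_leads hl h, fun h => h.of_leads_left hl⟩
        simp only [Ψ₁, Ψ₂, hR]
    · simp [Ψ₁, Ψ₂, hf]

/-- The matrix of the probabilities `ℙ(φ ∈ Γ_ij)`. -/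
noncomputable def forestMatrix (G : WeightedDigraph n) : Matrix (Fin n) (Fin n) ℝ :=
  Matrix.of fun i j => G.forestProb (G.inForestsRootedAt i j)

theorem one_add_laplacian_mul_forestMatrix (G : WeightedDigraph n) :
    (1 + G.laplacian) * G.forestMatrix = 1 := by
  ext i j
  have h := G.one_add_deg_mul_forestProb i j
  simp only [laplacian, add_mul, sub_mul, one_mul, Matrix.add_apply, Matrix.sub_apply,
    Matrix.diagonal_mul, Matrix.one_apply]
  simp only [Matrix.mul_apply, forestMatrix, Matrix.of_apply]
  linarith

/-- The left inverse form relates entries within a row of probabilities, which is what bounds the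
numbers of visits. -/
theorem forestMatrix_mul_one_add_laplacian (G : WeightedDigraph n) :
    G.forestMatrix * (1 + G.laplacian) = 1 :=
  mul_eq_one_comm.1 G.one_add_laplacian_mul_forestMatrix

theorem isUnit_one_add_laplacian (G : WeightedDigraph n) : IsUnit (1 + G.laplacian) :=
  IsUnit.of_mul_eq_one _ G.one_add_laplacian_mul_forestMatrix

theorem equilibrium_eq (G : WeightedDigraph n) (x : Fin n → ℝ) (i : Fin n) :
    G.equilibrium x i = ∑ j, G.forestProb (G.inForestsRootedAt i j) * x j := by
  rw [equilibrium, Matrix.inv_eq_right_inv G.one_add_laplacian_mul_forestMatrix]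
  rfl

/-- The expected number of visits of a random walk to its starting node. -/
theorem forestProb_self_le (G : WeightedDigraph n) {W : ℝ} (hW : ∀ i j, G.w i j ≤ W)
    (u : Fin n) : (1 + G.deg u) * G.forestProb (G.inForestsRootedAt u u) ≤ 1 + W := by
  -- The diagonal entry reads Q_uu (1 + d_u) = 1 + ∑_k Q_uk w_ku, and ∑_k Q_uk = 1.
  have h := congrFun (congrFun G.forestMatrix_mul_one_add_laplacian u) u
  simp only [laplacian, mul_add, mul_sub, mul_one, Matrix.add_apply, Matrix.sub_apply,
    Matrix.mul_diagonal, Matrix.one_apply, if_true] at h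
  simp only [Matrix.mul_apply, forestMatrix, Matrix.of_apply] at h
  have h2 : ∑ k, G.forestProb (G.inForestsRootedAt u k) * G.w k u ≤ W := by
    refine (Finset.sum_le_sum fun k _ =>
      mul_le_mul_of_nonneg_left (hW k u) (G.forestProb_nonneg _)).trans_eq ?_
    rw [← Finset.sum_mul, sum_forestProb, one_mul]
  linarith

/-! ### Convergence of the Friedkin–Johnsen dynamics -/

theorem sum_outNbrs (G : WeightedDigraph n) (i : Fin n) (y : Fin n → ℝ) :
    ∑ j ∈ G.outNbrs i, G.w i j * y j = ∑ j, G.w i j * y j := by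
  refine Finset.sum_subset (Finset.subset_univ _) fun j _ hj => ?_
  rw [G.w_eq_zero i j fun h => hj (Finset.mem_filter.2 ⟨Finset.mem_univ _, h⟩), zero_mul]

theorem fjUpdate_apply (G : WeightedDigraph n) (x y : Fin n → ℝ) (i : Fin n) :
    G.fjUpdate x y i = (x i + ∑ j, G.w i j * y j) / (1 + G.deg i) := by
  have h := G.sum_outNbrs i fun _ => 1
  simp only [mul_one] at h
  rw [fjUpdate, sum_outNbrs, h, deg]

theorem fjUpdate_equilibrium (G : WeightedDigraph n) (x : Fin n → ℝ) :
    G.fjUpdate x (G.equilibrium x) = G.equilibrium x := by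
  funext i
  rw [fjUpdate_apply, div_eq_iff (G.one_add_deg_pos i).ne']
  have h : (1 + G.laplacian).mulVec (G.equilibrium x) = x := by
    rw [equilibrium, Matrix.mulVec_mulVec, Matrix.mul_nonsing_inv _
      ((Matrix.isUnit_iff_isUnit_det _).1 G.isUnit_one_add_laplacian), Matrix.one_mulVec]
  have hi := congrFun h i
  rw [laplacian, Matrix.add_mulVec, Matrix.sub_mulVec, Matrix.one_mulVec, Pi.add_apply,
    Pi.sub_apply, Matrix.mulVec_diagonal] at hi
  simp only [Matrix.mulVec, dotProduct, Matrix.of_apply] at hi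
  linarith

/-- In the sup norm, coordinate `i` contracts by d_i / (1 + d_i). As t / (1 + t) increases in t and
every d_i is at most the total degree `D`, the factor D / (1 + D) < 1 serves for all coordinates. -/
theorem contractingWith_fjUpdate (G : WeightedDigraph n) (x : Fin n → ℝ) :
    ∃ K, ContractingWith K (G.fjUpdate x) := by
  set D : ℝ := ∑ i, G.deg i with hD
  have hD0 : 0 ≤ D := Finset.sum_nonneg fun i _ => G.deg_nonneg i
  have hK0 : 0 ≤ D / (1 + D) := by positivity
  refine ⟨Real.toNNReal (D / (1 + D)), ?_, LipschitzWith.of_dist_le_mul fun y z => ?_⟩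
  · rw [Real.toNNReal_lt_one, div_lt_one (by linarith)]
    linarith
  · rw [Real.coe_toNNReal _ hK0]
    refine (dist_pi_le_iff (by positivity)).2 fun i => ?_
    have hi : G.deg i ≤ D := Finset.single_le_sum (fun i _ => G.deg_nonneg i) (Finset.mem_univ i)
    have hp := G.one_add_deg_pos i
    rw [fjUpdate_apply, fjUpdate_apply, Real.dist_eq, ← sub_div, abs_div, abs_of_pos hp,
      add_sub_add_left_eq_sub, ← Finset.sum_sub_distrib, div_le_iff₀ hp]
    have h1 : |∑ j, (G.w i j * y j - G.w i j * z j)| ≤ G.deg i * dist y z := by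
      refine (Finset.abs_sum_le_sum_abs _ _).trans ?_
      rw [deg, Finset.sum_mul]
      refine Finset.sum_le_sum fun j _ => ?_
      rw [← mul_sub, abs_mul, abs_of_nonneg (G.w_nonneg i j)]
      exact mul_le_mul_of_nonneg_left (dist_le_pi_dist y z j) (G.w_nonneg i j)
    refine h1.trans ?_
    have h2 : G.deg i ≤ D / (1 + D) * (1 + G.deg i) := by
      rw [div_mul_eq_mul_div, le_div_iff₀ (by linarith)]
      nlinarith
    calc G.deg i * dist y z ≤ (D / (1 + D) * (1 + G.deg i)) * dist y z :=
          mul_le_mul_of_nonneg_right h2 dist_nonneg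
      _ = _ := by ring

theorem tendsto_fjUpdate (G : WeightedDigraph n) (x y : Fin n → ℝ) :
    Tendsto (fun k => (G.fjUpdate x)^[k] y) atTop (𝓝 (G.equilibrium x)) := by
  obtain ⟨K, hK⟩ := G.contractingWith_fjUpdate x
  rw [hK.fixedPoint_unique (G.fjUpdate_equilibrium x)]
  exact hK.tendsto_iterate_fixedPoint y

end WeightedDigraph

/-! ### Unrolling loops and comparing averaged laws -/

namespace RandProg

variable {α σ : Type}

theorem ev_iSup (p : RandProg α) (g : ℕ → α → ℝ≥0∞) (hg : ∀ a, Monotone fun k => g k a) :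
    (p.ev fun a => ⨆ k, g k a) = ⨆ k, p.ev (g k) := by
  simp only [ev, wp, ENNReal.mul_iSup]
  simp_rw [ENNReal.tsum_eq_iSup_sum]
  rw [iSup_comm]
  refine iSup_congr fun t => ?_
  exact ENNReal.finsetSum_iSup_of_monotone fun o k l hkl => mul_le_mul_right (hg o.1 hkl) _

/-- The fixed-point equation of the loop: shifting the fuel by one does not change the supremum,
which passes through the body by monotone convergence. -/
theorem ev_whileLoop (cond : σ → Bool) (body : σ → RandProg σ) (s : σ) (g : σ → ℝ≥0∞) :
    (whileLoop cond body s).ev g =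
      if cond s then (body s).ev fun s' => (whileLoop cond body s').ev g else g s := by
  have h : ∀ s, (whileLoop cond body s).ev g = ⨆ k, (whileFuel cond body k s).ev g :=
    fun s => wp_whileLoop cond body s _
  have hm : ∀ s, Monotone fun k => (whileFuel cond body k s).ev g :=
    fun s => wp_whileFuel_mono cond body s fun a _ => g a
  simp only [h]
  rw [← (hm s).iSup_nat_add 1]
  split_ifs with hc
  · rw [ev_iSup _ _ hm]
    refine iSup_congr fun k => (ev_whileFuel_succ cond body k s g).trans (if_pos hc)
  · simp only [ev_whileFuel_succ, hc, Bool.false_eq_true, if_false, ciSup_const]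

/-- An averaged law that is determined on bounded functions is determined. -/
theorem sum_mul_ev_eq_of_le_one {ι : Type*} [Fintype ι] (P : ι → RandProg α) (Q : ι → α)
    (a : ι → ℝ≥0∞)
    (h : ∀ g : α → ℝ≥0∞, (∀ x, g x ≤ 1) → ∑ i, a i * (P i).ev g = ∑ i, a i * g (Q i))
    (g : α → ℝ≥0∞) : ∑ i, a i * (P i).ev g = ∑ i, a i * g (Q i) := by
  classical
  have h1 : ∀ i, a i * (P i).ev g =
      ∑' x, a i * ((P i).ev fun b => if b = x then 1 else 0) * g x := by
    intro i
    rw [ev_eq_tsum, ← ENNReal.tsum_mul_left]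
    simp only [mul_assoc]
  simp only [h1]
  rw [← Summable.tsum_finsetSum fun _ _ => ENNReal.summable]
  simp only [← Finset.sum_mul]
  -- Indicators of single results are bounded by one, and these point masses determine the
  -- expectation of any `g`.
  have h2 : ∀ x : α, ∑ i, a i * ((P i).ev fun b => if b = x then 1 else 0) =
      ∑ i, a i * if Q i = x then 1 else 0 :=
    fun x => h _ fun b => by split_ifs <;> simp
  simp only [h2, Finset.sum_mul]
  rw [Summable.tsum_finsetSum fun _ _ => ENNReal.summable]
  refine Finset.sum_congr rfl fun i _ => ?_
  rw [tsum_eq_single (Q i)]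
  · simp
  · intro x hx
    simp [hx.symm]

end RandProg

namespace WeightedDigraph

open PointerMap RandProg

variable {n : ℕ}

/-! ### The two loops -/

/-- The test of both inner loops: the current node is not in the forest. -/
def unvisited (p : Fin n × SampleState n) : Bool := !p.2.inforest p.1

/-- The state after `u` has joined the forest as a root. -/
def absorb (u : Fin n) (s : SampleState n) : SampleState n where
  inforest := Function.update s.inforest u true
  next := Function.update s.next u none
  root := Function.update s.root u (some u)

/-- The state after `v` has been recorded as the next node of `u`. -/
def record (u v : Fin n) (s : SampleState n) : SampleState n :=
  { s with next := Function.update s.next u (some v) }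

/-- The state after `u` has joined the forest with root `r`. -/
def attach (r : Option (Fin n)) (u : Fin n) (s : SampleState n) : SampleState n :=
  { s with
    inforest := Function.update s.inforest u true
    root := Function.update s.root u r }

theorem walkBody_eq (G : WeightedDigraph n) (u : Fin n) (s : SampleState n) :
    G.walkBody (u, s) = randLE (1 / (1 + G.deg u)) >>= fun absorbed =>
      if absorbed then tick 3 >>= fun _ => pure (u, absorb u s)
      else G.randomSuccessor u >>= fun v => tick 2 >>= fun _ => pure (v, record u v s) := rfl

theorem retraceBody_eq (r : Option (Fin n)) (u : Fin n) (s : SampleState n) :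
    retraceBody r (u, s) = tick 3 >>= fun _ => pure ((s.next u).getD u, attach r u s) := rfl

theorem visitNode_eq (G : WeightedDigraph n) (s : SampleState n) (i : Fin n) :
    G.visitNode s i = tick 2 >>= fun _ => whileLoop unvisited G.walkBody (i, s) >>= fun p =>
      tick 2 >>= fun _ => whileLoop unvisited (retraceBody (p.2.root p.1)) (i, p.2) >>= fun q =>
        pure q.2 := rfl

theorem sampleForest_eq (G : WeightedDigraph n) : G.sampleForest = tick (3 * n) >>= fun _ =>
    List.foldlM G.visitNode (SampleState.init n) (List.finRange n) := rfl

/-- The transition probabilities of the walk; the choice `none` ends it. -/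
noncomputable def stepProb (G : WeightedDigraph n) (u : Fin n) (c : Option (Fin n)) : ℝ≥0∞ :=
  ENNReal.ofReal (G.pointerWeight u c / (1 + G.deg u))

theorem sum_stepProb (G : WeightedDigraph n) (u : Fin n) : ∑ c, G.stepProb u c = 1 := by
  unfold stepProb
  rw [← ENNReal.ofReal_sum_of_nonneg fun c _ =>
    div_nonneg (G.pointerWeight_nonneg u c) (G.one_add_deg_pos u).le, ← Finset.sum_div,
    sum_pointerWeight, div_self (G.one_add_deg_pos u).ne', ENNReal.ofReal_one]

theorem stepProb_none_add (G : WeightedDigraph n) (u : Fin n) :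
    G.stepProb u none + ∑ v, G.stepProb u (some v) = 1 := by
  rw [← G.sum_stepProb u, Fintype.sum_option]

theorem wp_randomSuccessor (G : WeightedDigraph n) (u : Fin n) (g : Fin n → ℕ → ℝ≥0∞) :
    (G.randomSuccessor u).wp g =
      ∑ v, ENNReal.ofReal (G.w u v / G.deg u) * g v (outCount G.arcs u) :=
  (wp_of_const_cost (fun v => ENNReal.ofReal (G.w u v / G.deg u)) _ g).trans (tsum_fintype _)

/-- The two draws act as one choice in `Option (Fin n)`, since (1 - 1/(1 + d_u)) · w_uv / d_u = w_uv
/ (1 + d_u). The costs are 2 + 3 for absorption and 2 + outdegree + 2 for a move. -/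
theorem wp_walkBody (G : WeightedDigraph n) (u : Fin n) (s : SampleState n)
    (g : Fin n × SampleState n → ℕ → ℝ≥0∞) :
    (G.walkBody (u, s)).wp g = G.stepProb u none * g (u, absorb u s) 5 +
      ∑ v, G.stepProb u (some v) * g (v, record u v s) (outCount G.arcs u + 4) := by
  have hp := G.one_add_deg_pos u
  have hd := G.deg_nonneg u
  rw [walkBody_eq, wp_bind, wp_randLE (by positivity) ((div_le_one hp).2 (by linarith))]
  simp only [if_true, Bool.false_eq_true, if_false, wp_bind, wp_tick, wp_pure,
    wp_randomSuccessor, Finset.mul_sum]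
  congr 1
  refine Finset.sum_congr rfl fun v _ => ?_
  rw [← mul_assoc, ← ENNReal.ofReal_mul (by rw [sub_nonneg, div_le_one hp]; linarith)]
  congr 2
  -- For d_u = 0 all weights out of `u` vanish and both sides are zero, so the division by zero is
  -- harmless.
  · rcases hd.eq_or_lt with h0 | h0
    · have hv : G.w u v = 0 := le_antisymm
        ((Finset.single_le_sum (fun v _ => G.w_nonneg u v) (Finset.mem_univ v)).trans_eq h0.symm)
        (G.w_nonneg u v)
      simp [hv, pointerWeight]
    · change _ = G.w u v / _
      field_simp
      ring
  · omega

theorem ev_walkBody (G : WeightedDigraph n) (u : Fin n) (s : SampleState n)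
    (g : Fin n × SampleState n → ℝ≥0∞) :
    (G.walkBody (u, s)).ev g = G.stepProb u none * g (u, absorb u s) +
      ∑ v, G.stepProb u (some v) * g (v, record u v s) :=
  G.wp_walkBody u s _

theorem mass_walkBody (G : WeightedDigraph n) (p : Fin n × SampleState n) :
    ((G.walkBody p).ev fun _ => 1) = 1 := by
  obtain ⟨u, s⟩ := p
  rw [ev_walkBody]
  simp only [mul_one]
  exact G.stepProb_none_add u

theorem expectedCost_walkBody_le (G : WeightedDigraph n) (u : Fin n) (s : SampleState n) :
    (G.walkBody (u, s)).expectedCost ≤ (outCount G.arcs u + 5 : ℕ) := by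
  rw [expectedCost_eq_wp, wp_walkBody, ← mul_one ((outCount G.arcs u + 5 : ℕ) : ℝ≥0∞),
    ← G.stepProb_none_add u, mul_add, Finset.mul_sum]
  refine add_le_add ?_ (Finset.sum_le_sum fun v _ => ?_)
  · rw [mul_comm]
    gcongr
    omega
  · rw [mul_comm]
    gcongr
    omega

theorem wp_retraceBody (r : Option (Fin n)) (u : Fin n) (s : SampleState n)
    (g : Fin n × SampleState n → ℕ → ℝ≥0∞) :
    (retraceBody r (u, s)).wp g = g ((s.next u).getD u, attach r u s) 3 := by
  rw [retraceBody_eq, wp_bind, wp_tick, wp_pure]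

theorem mass_retraceBody (r : Option (Fin n)) (p : Fin n × SampleState n) :
    ((retraceBody r p).ev fun _ => 1) = 1 :=
  wp_retraceBody r p.1 p.2 _

theorem mass_visitNode_le_one (G : WeightedDigraph n) (s : SampleState n) (i : Fin n) :
    ((G.visitNode s i).ev fun _ => 1) ≤ 1 := by
  rw [visitNode_eq]
  refine mass_tick_bind_le_one fun _ => mass_bind_le_one
    (mass_whileLoop_le_one _ _ (fun p => (G.mass_walkBody p).le) _) fun p =>
    mass_tick_bind_le_one fun _ => mass_bind_le_one
      (mass_whileLoop_le_one _ _ (fun q => (mass_retraceBody _ q).le) _) fun q => ?_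
  rw [ev_pure]

/-- Every walk ends with probability one. -/
theorem mass_walk (G : WeightedDigraph n) (p : Fin n × SampleState n) :
    ((whileLoop unvisited G.walkBody p).ev fun _ => 1) = 1 := by
  set M : Fin n × SampleState n → ℝ≥0∞ := fun p =>
    (whileLoop unvisited G.walkBody p).ev fun _ => 1 with hM
  have hM1 : ∀ p, M p ≤ 1 := mass_whileLoop_le_one _ _ fun p => (G.mass_walkBody p).le
  suffices h : 1 ≤ ⨅ p, M p from le_antisymm (hM1 p) (h.trans (iInf_le _ p))
  set m := ⨅ p, M p with hm
  have hm1 : m ≤ 1 := (iInf_le _ p).trans (hM1 p)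
  have hmtop : m ≠ ∞ := ne_top_of_le_ne_top ENNReal.one_ne_top hm1
  by_contra hlt
  set r := m.toReal with hr
  have hmr : m = ENNReal.ofReal r := (ENNReal.ofReal_toReal hmtop).symm
  have hr0 : 0 ≤ r := ENNReal.toReal_nonneg
  have hr1 : r < 1 := by
    have := (ENNReal.toReal_lt_toReal hmtop ENNReal.one_ne_top).2 (not_le.1 hlt)
    simpa using this
  set D : ℝ := ∑ u, G.deg u with hD
  have hD0 : 0 ≤ D := Finset.sum_nonneg fun u _ => G.deg_nonneg u
  -- Let m be the infimum of the halting probabilities over all states. One step gives halting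
  -- probability at least p + (1 - p) m = m + (1 - m) p with p = 1/(1 + d_u) ≥ 1/(1 + D), so m ≥ m +
  -- (1 - m)/(1 + D), which is impossible for m < 1.
  have key : ENNReal.ofReal (r + (1 - r) / (1 + D)) ≤ m := by
    refine le_iInf fun p => ?_
    obtain ⟨u, s⟩ := p
    have hu : G.deg u ≤ D := Finset.single_le_sum (fun i _ => G.deg_nonneg i) (Finset.mem_univ u)
    have hp := G.one_add_deg_pos u
    have hd := G.deg_nonneg u
    have hle : r + (1 - r) / (1 + D) ≤ 1 := by
      have : (1 - r) / (1 + D) ≤ 1 - r := div_le_self (by linarith) (by linarith)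
      linarith
    simp only [hM]
    rw [ev_whileLoop]
    split_ifs
    · rw [ev_walkBody]
      have h1 : M (u, absorb u s) = 1 := by
        simp only [hM]
        rw [ev_whileLoop]
        simp [unvisited, absorb]
      have h2 : G.stepProb u none * 1 + ∑ v, G.stepProb u (some v) * m ≤
          G.stepProb u none * M (u, absorb u s) +
            ∑ v, G.stepProb u (some v) * M (v, record u v s) := by
        rw [h1]
        gcongr
        exact iInf_le _ _
      refine le_trans ?_ h2
      rw [mul_one, ← Finset.sum_mul, hmr]
      unfold stepProb
      rw [← ENNReal.ofReal_sum_of_nonneg fun v _ => div_nonneg (G.pointerWeight_nonneg u _) hp.le,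
        ← Finset.sum_div, ← ENNReal.ofReal_mul (div_nonneg
          (Finset.sum_nonneg fun v _ => G.pointerWeight_nonneg u _) hp.le),
        ← ENNReal.ofReal_add (div_nonneg (G.pointerWeight_nonneg u _) hp.le) (mul_nonneg (div_nonneg
          (Finset.sum_nonneg fun v _ => G.pointerWeight_nonneg u _) hp.le) hr0)]
      refine ENNReal.ofReal_le_ofReal ?_
      change _ ≤ 1 / (1 + G.deg u) + G.deg u / (1 + G.deg u) * r
      have h3 : 1 / (1 + G.deg u) + G.deg u / (1 + G.deg u) * r =
          r + (1 - r) / (1 + G.deg u) := by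
        field_simp
        ring
      rw [h3]
      gcongr
    · rw [← ENNReal.ofReal_one]
      exact ENNReal.ofReal_le_ofReal hle
  rw [hmr, ENNReal.ofReal_le_ofReal_iff hr0] at key
  have : 0 < (1 - r) / (1 + D) := div_pos (by linarith) (by linarith)
  linarith

/-! ### Stale records do not matter -/

/-- Two states agree on their common forest, which contains `S`. -/
structure SameForest (S : Set (Fin n)) (s t : SampleState n) : Prop where
  inforest_eq : s.inforest = t.inforest
  next_eq : ∀ a, s.inforest a = true → s.next a = t.next a
  root_eq : ∀ a, s.inforest a = true → s.root a = t.root a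
  mem : ∀ a ∈ S, s.inforest a = true

theorem SameForest.absorb {S : Set (Fin n)} {s t : SampleState n} (h : SameForest S s t)
    (u : Fin n) : SameForest S (absorb u s) (absorb u t) where
  inforest_eq := by simp only [WeightedDigraph.absorb, h.inforest_eq]
  next_eq a ha := by
    by_cases hau : a = u
    · simp [WeightedDigraph.absorb, hau]
    · simp only [WeightedDigraph.absorb, Function.update_of_ne hau] at ha ⊢
      exact h.next_eq a ha
  root_eq a ha := by
    by_cases hau : a = u
    · simp [WeightedDigraph.absorb, hau]
    · simp only [WeightedDigraph.absorb, Function.update_of_ne hau] at ha ⊢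
      exact h.root_eq a ha
  mem a ha := by
    by_cases hau : a = u
    · simp [WeightedDigraph.absorb, hau]
    · simp only [WeightedDigraph.absorb, Function.update_of_ne hau]
      exact h.mem a ha

theorem SameForest.record {S : Set (Fin n)} {s t : SampleState n} (h : SameForest S s t)
    {u : Fin n} (hu : s.inforest u = false) (v : Fin n) :
    SameForest S (record u v s) (record u v t) where
  inforest_eq := h.inforest_eq
  next_eq a ha := by
    have hau : a ≠ u := by
      rintro rfl
      exact absurd (show s.inforest a = true from ha) (by simp [hu])
    simp only [WeightedDigraph.record, Function.update_of_ne hau]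
    exact h.next_eq a ha
  root_eq := h.root_eq
  mem := h.mem

theorem SameForest.attach {S : Set (Fin n)} {s t : SampleState n} (h : SameForest S s t)
    {u : Fin n} (hu : s.next u = t.next u) (r : Option (Fin n)) :
    SameForest S (attach r u s) (attach r u t) where
  inforest_eq := by simp only [WeightedDigraph.attach, h.inforest_eq]
  next_eq a ha := by
    by_cases hau : a = u
    · subst hau
      exact hu
    · simp only [WeightedDigraph.attach, Function.update_of_ne hau] at ha
      exact h.next_eq a ha
  root_eq a ha := by
    by_cases hau : a = u
    · simp [WeightedDigraph.attach, hau]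
    · simp only [WeightedDigraph.attach, Function.update_of_ne hau] at ha ⊢
      exact h.root_eq a ha
  mem a ha := by
    by_cases hau : a = u
    · simp [WeightedDigraph.attach, hau]
    · simp only [WeightedDigraph.attach, Function.update_of_ne hau]
      exact h.mem a ha

/-- The invariant of two coupled walks from `i`. -/
def WalkCoupled (S : Set (Fin n)) (i : Fin n) (p q : Fin n × SampleState n) : Prop :=
  p.1 = q.1 ∧ SameForest S p.2 q.2 ∧ CommonPath p.2.next q.2.next p.1 i

/-- The walk consults only its position and the forest, so both walks can make the same draws. The
records on the loop-erased path from `i` to the current node were written by the walks themselves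
and therefore coincide. -/
theorem coupled_walk (G : WeightedDigraph n) {S : Set (Fin n)} {i : Fin n}
    {s t : SampleState n} (h : SameForest S s t) :
    Coupled (fun p q => WalkCoupled S i p q ∧ unvisited p = false)
      (whileLoop unvisited G.walkBody (i, s)) (whileLoop unvisited G.walkBody (i, t)) := by
  refine Coupled.whileLoop (R := WalkCoupled S i) ?_ ?_ ⟨rfl, h, .refl⟩
  · rintro ⟨u, s⟩ ⟨v, t⟩ ⟨rfl, h, _⟩
    exact congrArg (fun A : Fin n → Bool => !A u) h.inforest_eq
  · rintro ⟨u, s⟩ ⟨v, t⟩ ⟨rfl, h, hp⟩ hc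
    rw [walkBody_eq, walkBody_eq]
    refine (Coupled.refl _).bind ?_
    rintro b _ rfl
    split_ifs
    · refine (Coupled.refl _).bind fun _ _ _ => Coupled.pure ⟨rfl, h.absorb u, hp.update none⟩
    · refine (Coupled.refl _).bind ?_
      rintro v _ rfl
      refine (Coupled.refl _).bind fun _ _ _ => Coupled.pure ⟨rfl, h.record ?_ v, hp.extend⟩
      simpa [unvisited] using hc

/-- The invariant of two coupled retraces from `i`. -/
def RetraceCoupled (S : Set (Fin n)) (i : Fin n) (p q : Fin n × SampleState n) : Prop :=
  p.1 = q.1 ∧ SameForest S p.2 q.2 ∧ (p.2.inforest i = true ∨ p.1 = i) ∧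
    ∃ u, p.2.inforest u = true ∧ CommonPath p.2.next q.2.next u p.1

/-- The retrace reads records only along the common path, which ends at a node `u` of the forest.
The third clause of the invariant ensures that `i` is in the forest at the end. -/
theorem coupled_retrace {S : Set (Fin n)} {i u : Fin n} {s t : SampleState n}
    (h : SameForest S s t) (hu : s.inforest u = true) (hp : CommonPath s.next t.next u i)
    (r : Option (Fin n)) :
    Coupled (fun p q => RetraceCoupled S i p q ∧ unvisited p = false)
      (whileLoop unvisited (retraceBody r) (i, s))
      (whileLoop unvisited (retraceBody r) (i, t)) := by
  refine Coupled.whileLoop (R := RetraceCoupled S i) ?_ ?_ ⟨rfl, h, .inr rfl, u, hu, hp⟩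
  · rintro ⟨u, s⟩ ⟨v, t⟩ ⟨rfl, h, _⟩
    exact congrArg (fun A : Fin n → Bool => !A u) h.inforest_eq
  · rintro ⟨a, s⟩ ⟨b, t⟩ ⟨rfl, h, hi, u, hu, hp⟩ hc
    rw [retraceBody_eq, retraceBody_eq]
    refine (Coupled.refl _).bind fun _ _ _ => Coupled.pure ?_
    dsimp only at hp hi hu h
    -- The common path cannot be exhausted here: its end is in the forest, but the current node is
    -- not.
    cases hp with
    | refl => simp [unvisited, hu] at hc
    | @step _ b hau h1 h2 h3 =>
      rw [h1, h2]
      refine ⟨rfl, h.attach (h1.trans h2.symm) r, .inl ?_, u, ?_, h3⟩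
      · rcases hi with hi | rfl
        · by_cases hia : i = a
          · simp [attach, hia]
          · simpa [attach, hia] using hi
        · simp [attach]
      · simp [attach, Ne.symm hau, hu]

theorem coupled_visitNode (G : WeightedDigraph n) {S : Set (Fin n)} {s t : SampleState n}
    (h : SameForest S s t) (i : Fin n) :
    Coupled (SameForest (insert i S)) (G.visitNode s i) (G.visitNode t i) := by
  rw [visitNode_eq, visitNode_eq]
  refine (Coupled.refl _).bind fun _ _ _ => (G.coupled_walk h).bind ?_
  rintro ⟨u, s⟩ ⟨_, t⟩ ⟨⟨rfl, h, hp⟩, hc⟩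
  have hu : s.inforest u = true := by simpa [unvisited] using hc
  refine (Coupled.refl _).bind fun _ _ _ => ?_
  dsimp only at h hp ⊢
  rw [← h.root_eq u hu]
  refine (coupled_retrace h hu hp _).bind ?_
  rintro ⟨a, s⟩ ⟨_, t⟩ ⟨⟨rfl, h, hi, _⟩, hc⟩
  refine Coupled.pure ⟨h.inforest_eq, h.next_eq, h.root_eq, ?_⟩
  rintro b (rfl | hb)
  · rcases hi with hi | rfl
    · exact hi
    · simpa [unvisited] using hc
  · exact h.mem b hb

theorem coupled_foldlM_visitNode (G : WeightedDigraph n) (l : List (Fin n)) {S : Set (Fin n)}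
    {s t : SampleState n} (h : SameForest S s t) :
    Coupled (SameForest (S ∪ {i | i ∈ l})) (List.foldlM G.visitNode s l)
      (List.foldlM G.visitNode t l) := by
  induction l generalizing S s t with
  | nil => exact Coupled.pure (by simpa using h)
  | cons i l ih =>
    rw [List.foldlM_cons, List.foldlM_cons]
    refine (G.coupled_visitNode h i).bind fun s t hst => (ih hst).mono fun a b hab => ?_
    convert hab using 1
    ext x
    simp only [Set.mem_union, Set.mem_ofPred_eq, List.mem_cons, Set.mem_insert_iff]
    tauto

/-- Once all nodes are in the forest, no stale records remain. -/
theorem SameForest.eq {s t : SampleState n} (h : SameForest Set.univ s t) : s = t := by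
  obtain ⟨s1, s2, s3⟩ := s
  obtain ⟨t1, t2, t3⟩ := t
  obtain ⟨h1, h2, h3, h4⟩ := h
  dsimp only at h1 h2 h3 h4
  simp only [SampleState.mk.injEq]
  exact ⟨h1, funext fun a => h2 a (h4 a trivial), funext fun a => h3 a (h4 a trivial)⟩

/-- A round does not depend on the initial records. -/
theorem foldlM_visitNode_wp_eq (G : WeightedDigraph n) {s t : SampleState n}
    (h : SameForest ∅ s t) (g : SampleState n → ℕ → ℝ≥0∞) :
    wp (List.foldlM G.visitNode s (List.finRange n)) g =
      wp (List.foldlM G.visitNode t (List.finRange n)) g := by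
  refine G.coupled_foldlM_visitNode (List.finRange n) h g g fun a b hab k => ?_
  have : (∅ : Set (Fin n)) ∪ {i | i ∈ List.finRange n} = Set.univ := by
    ext x
    simp
  rw [this] at hab
  rw [hab.eq]

end WeightedDigraph

namespace WeightedDigraph

open PointerMap RandProg

variable {n : ℕ}

/-! ### Starting a round from random records -/

open scoped Classical in
/-- The root at which the pointers starting from `a` end, if there is one. -/
noncomputable def rootOf (f : Fin n → Option (Fin n)) (a : Fin n) : Option (Fin n) :=
  if h : ∃ r, RootOf f a r then some h.choose else none

theorem rootOf_eq_some {f : Fin n → Option (Fin n)} {a r : Fin n} (h : RootOf f a r) :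
    rootOf f a = some r := by
  have h' : ∃ r, RootOf f a r := ⟨r, h⟩
  rw [rootOf, dif_pos h', Option.some.injEq]
  exact h'.choose_spec.unique h

theorem rootOf_congr {f g : Fin n → Option (Fin n)} {a b : Fin n}
    (h : ∀ r, RootOf f a r ↔ RootOf g b r) : rootOf f a = rootOf g b := by
  by_cases ha : ∃ r, RootOf f a r
  · obtain ⟨r, hr⟩ := ha
    rw [rootOf_eq_some hr, rootOf_eq_some ((h r).1 hr)]
  · have hb : ¬ ∃ r, RootOf g b r := fun ⟨r, hr⟩ => ha ⟨r, (h r).2 hr⟩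
    rw [rootOf, rootOf, dif_neg ha, dif_neg hb]

theorem rootOf_eq_of_leads {f : Fin n → Option (Fin n)} {a b : Fin n} (h : Leads f a b) :
    rootOf f a = rootOf f b :=
  rootOf_congr fun _ => ⟨fun hr => hr.of_leads_left h, .of_leads h⟩

theorem rootOf_update {f : Fin n → Option (Fin n)} {S : Set (Fin n)} {u a : Fin n}
    (hu : u ∉ Reached f S) (ha : a ∈ Reached f S) (c : Option (Fin n)) :
    rootOf (Function.update f u c) a = rootOf f a := by
  have key : ∀ g : Fin n → Option (Fin n), u ∉ Reached g S → a ∈ Reached g S → ∀ c r,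
      RootOf g a r → RootOf (Function.update g u c) a r := by
    intro g hu ha c r hr
    refine hr.congr fun x hx => Function.update_of_ne ?_ _ _
    rintro rfl
    exact hu (hx.mem_reached ha)
  refine rootOf_congr fun r => ⟨fun hr => ?_, key f hu ha c r⟩
  have h := reached_update hu c
  have := key _ (h.symm ▸ hu) (h.symm ▸ ha) (f u) r hr
  rwa [Function.update_idem, Function.update_eq_self] at this

open scoped Classical in
/-- The state with records `f` in which the nodes of `S` have been treated. -/
noncomputable def forestState (S : Set (Fin n)) (f : Fin n → Option (Fin n)) : SampleState n where
  inforest a := decide (a ∈ Reached f S)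
  next := f
  root a := if a ∈ Reached f S then rootOf f a else none

theorem record_forestState {S : Set (Fin n)} {f : Fin n → Option (Fin n)} {u : Fin n}
    (hu : u ∉ Reached f S) (v : Fin n) :
    record u v (forestState S f) = forestState S (Function.update f u (some v)) := by
  classical
  simp only [record, forestState, SampleState.mk.injEq, reached_update hu, true_and]
  funext a
  split_ifs with ha
  · exact (rootOf_update hu ha _).symm
  · rfl

/-- With an empty forest agreement is vacuous, so a round may be started from arbitrary records `f`.
-/
theorem sameForest_init (f : Fin n → Option (Fin n)) :
    SameForest ∅ (SampleState.init n) (forestState ∅ f) where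
  inforest_eq := by
    funext a
    simp [forestState, SampleState.init, reached_empty]
  next_eq a ha := by simp [SampleState.init] at ha
  root_eq a ha := by simp [SampleState.init] at ha
  mem a ha := absurd ha (Set.notMem_empty a)

theorem unvisited_forestState {S : Set (Fin n)} {f : Fin n → Option (Fin n)} {u : Fin n} :
    unvisited (u, forestState S f) = true ↔ u ∉ Reached f S := by
  simp [unvisited, forestState]

theorem unvisited_absorb (u : Fin n) (s : SampleState n) :
    unvisited (u, absorb u s) = false := by
  simp [unvisited, absorb]

/-! ### The retrace loop -/

open scoped Classical in
/-- The state after the nodes met from `a` have joined the forest with root `r`. -/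
noncomputable def retraced (r : Option (Fin n)) (a : Fin n) (s : SampleState n) :
    SampleState n where
  inforest x := s.inforest x || decide (Leads s.next a x)
  next := s.next
  root x := if s.inforest x = false ∧ Leads s.next a x then r else s.root x

theorem leads_iff {f : Fin n → Option (Fin n)} {a b x : Fin n} (h : f a = some b) :
    Leads f a x ↔ a = x ∨ Leads f b x := by
  constructor
  · intro hl
    rcases hl.cases_head with h' | ⟨c, hc, hl⟩
    · exact .inl h'
    · rw [h, Option.some.injEq] at hc
      exact .inr (hc ▸ hl)
  · rintro (rfl | hl)
    · exact .refl
    · exact .head h hl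

theorem retraced_of_mem {r : Option (Fin n)} {a : Fin n} {s : SampleState n}
    (h : ∀ x, Leads s.next a x → s.inforest x = true) : retraced r a s = s := by
  classical
  obtain ⟨A, f, ρ⟩ := s
  simp only [retraced, SampleState.mk.injEq, true_and]
  constructor
  · funext x
    by_cases hx : Leads f a x
    · simpa [hx] using (h x hx).symm
    · simp [hx]
  · funext x
    refine if_neg ?_
    rintro ⟨h1, h2⟩
    exact absurd (h x h2) (by simp [h1])

/-- Induction along the path from `a` to its root. By `hs`, whatever follows a forest node on the
path is already in the forest, so stopping at the first such node omits nothing. -/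
theorem ev_retrace (r : Option (Fin n)) {a ρ : Fin n} (s : SampleState n)
    (ha : RootOf s.next a ρ)
    (hs : ∀ x, Leads s.next a x → s.inforest x = true → ∀ y, Leads s.next x y →
      s.inforest y = true) (g : SampleState n → ℝ≥0∞) :
    ((whileLoop unvisited (retraceBody r) (a, s)).ev fun p => g p.2) = g (retraced r a s) := by
  classical
  obtain ⟨A, f, root⟩ := s
  dsimp only at ha hs
  induction ha generalizing A root with
  | @root a hf =>
    rw [ev_whileLoop]
    have hl : ∀ x, Leads f a x ↔ a = x := fun x =>
      ⟨fun h => h.eq_of_none hf, fun h => h ▸ .refl⟩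
    split_ifs with hc
    · have hA : A a = false := by simpa [unvisited] using hc
      rw [ev, wp_retraceBody, ev_whileLoop, if_neg (by simp [unvisited, attach, hf])]
      congr 1
      simp only [attach, retraced, SampleState.mk.injEq, true_and, hl]
      constructor
      · funext x
        by_cases hx : x = a
        · simp [hx]
        · simp [hx, Ne.symm hx]
      · funext x
        by_cases hx : x = a
        · simp [hx, hA]
        · simp [hx, Ne.symm hx]
    · have hA : A a = true := by simpa [unvisited] using hc
      rw [retraced_of_mem]
      intro x hx
      exact (hl x).1 hx ▸ hA
  | @step a b ρ hf hb ih =>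
    rw [ev_whileLoop]
    split_ifs with hc
    · have hA : A a = false := by simpa [unvisited] using hc
      -- The remaining path does not return to `a`, so marking `a` does not affect the hypothesis on
      -- it.
      have hba : ¬ Leads f b a := fun h =>
        (RootOf.step hf hb).not_transGen (.head' hf h)
      rw [ev, wp_retraceBody]
      simp only [hf, Option.getD_some, attach]
      rw [ih]
      · congr 1
        simp only [retraced, SampleState.mk.injEq, true_and, leads_iff hf]
        constructor
        · funext x
          by_cases hx : x = a
          · simp [hx]
          · simp [hx, Ne.symm hx]
        · funext x
          by_cases hx : x = a
          · simp [hx, hA]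
          · simp [hx, Ne.symm hx]
      · intro x hx hxA y hy
        have hxa : x ≠ a := by
          rintro rfl
          exact hba hx
        rw [Function.update_of_ne hxa] at hxA
        have hya : y ≠ a := by
          rintro rfl
          exact hba (Relation.ReflTransGen.trans hx hy)
        rw [Function.update_of_ne hya]
        exact hs x (.head hf hx) hxA y hy
    · have hA : A a = true := by simpa [unvisited] using hc
      rw [retraced_of_mem]
      exact hs a .refl hA

/-- The nodes added share the root of `i`, which is that of the node `u` where the walk hit the
forest. -/
theorem retraced_forestState {S : Set (Fin n)} {i u : Fin n} {f : Fin n → Option (Fin n)}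
    (hu : u ∈ Reached f S) (hl : Leads f i u) :
    retraced ((forestState S f).root u) i (forestState S f) = forestState (insert i S) f := by
  classical
  simp only [retraced, forestState, SampleState.mk.injEq, true_and, mem_reached_insert, if_pos hu]
  constructor
  · funext x
    rw [Bool.eq_iff_iff, Bool.or_eq_true, decide_eq_true_iff, decide_eq_true_iff]
    exact or_congr_right decide_eq_true_iff
  · funext x
    by_cases hx : x ∈ Reached f S
    · simp [hx]
    · by_cases hix : Leads f i x
      · simp only [hx, hix, decide_false, and_self, if_true, or_true]
        rw [← rootOf_eq_of_leads hl, rootOf_eq_of_leads hix]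
      · simp [hx, hix]

theorem retraced_absorb {S : Set (Fin n)} {i u : Fin n} {f : Fin n → Option (Fin n)}
    (hu : u ∉ Reached f S) (hl : Leads (Function.update f u none) i u) :
    retraced ((absorb u (forestState S f)).root u) i (absorb u (forestState S f)) =
      forestState (insert i S) (Function.update f u none) := by
  classical
  have hru : rootOf (Function.update f u none) u = some u := rootOf_eq_some (.root (by simp))
  simp only [retraced, forestState, absorb, SampleState.mk.injEq, true_and, mem_reached_insert,
    reached_update hu, Function.update_self]
  constructor
  · funext x
    rw [Bool.eq_iff_iff]
    by_cases hx : x = u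
    · simp [hx, hl]
    · rw [Function.update_of_ne hx, Bool.or_eq_true, decide_eq_true_iff, decide_eq_true_iff]
      exact or_congr_right decide_eq_true_iff
  · funext x
    by_cases hx : x = u
    · simp [hx, hl, hru]
    · rw [Function.update_of_ne hx, Function.update_of_ne hx]
      by_cases hxS : x ∈ Reached f S
      · simp [hxS, rootOf_update hu hxS]
      · by_cases hix : Leads (Function.update f u none) i x
        · simp only [hxS, hix, decide_false, and_self, if_true, or_true]
          rw [← rootOf_eq_of_leads hix, rootOf_eq_of_leads hl, hru]
        · simp [hxS, hix]

/-! ### Occupation of the walk -/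

/-- The walk from `i`, started from random records when the nodes of `S` have been treated, may
be at `u` with records `f`. -/
structure Occupied (S : Set (Fin n)) (i u : Fin n) (f : Fin n → Option (Fin n)) : Prop where
  acyclic_cut : Acyclic (Function.update f u none)
  path : PathAvoiding (Reached f S) f u i
  acyclic : u ∈ Reached f S → Acyclic f

theorem Occupied.update {S : Set (Fin n)} {i u : Fin n} {f : Fin n → Option (Fin n)}
    (h : Occupied S i u f) (hu : u ∉ Reached f S) (c : Option (Fin n)) :
    Occupied S i u (Function.update f u c) where
  acyclic_cut := by
    rw [Function.update_idem]
    exact h.acyclic_cut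
  path := by
    rw [reached_update hu]
    exact h.path.congr fun x hx => Function.update_of_ne hx _ _
  acyclic hu' := absurd hu' (by rwa [reached_update hu])

/-- While `u` is outside the finished forest, the condition does not involve the pointer of `u`;
this freedom allows it to be resampled. The converse restores the old pointer. -/
theorem occupied_update_iff {S : Set (Fin n)} {i u : Fin n} (f : Fin n → Option (Fin n))
    (c : Option (Fin n)) :
    (Occupied S i u (Function.update f u c) ∧ u ∉ Reached (Function.update f u c) S) ↔
      Occupied S i u f ∧ u ∉ Reached f S := by
  have key : ∀ (f : Fin n → Option (Fin n)) c, Occupied S i u f ∧ u ∉ Reached f S →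
      Occupied S i u (Function.update f u c) ∧ u ∉ Reached (Function.update f u c) S :=
    fun f c h => ⟨h.1.update h.2 c, by rw [reached_update h.2]; exact h.2⟩
  refine ⟨fun h => ?_, key f c⟩
  have := key _ (f u) h
  rwa [Function.update_idem, Function.update_eq_self] at this

/-- A cycle through `u` also passes the next node `v`, so the cut may move to `v`. If `v` is already
reached there is no cycle, because the path from `v` cannot return to `u`. -/
theorem Occupied.next {S : Set (Fin n)} {i u v : Fin n} {f : Fin n → Option (Fin n)}
    (h : Occupied S i u f) (hu : u ∉ Reached f S) (hv : f u = some v) : Occupied S i v f where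
  acyclic_cut := h.acyclic_cut.cut_next hv
  path := h.path.extend hu hv
  acyclic hvS := h.acyclic_cut.of_cut hu hvS hv

theorem occupied_self (S : Set (Fin n)) (i : Fin n) {f : Fin n → Option (Fin n)}
    (hf : Acyclic f) : Occupied S i i f :=
  ⟨hf.update_none i, .refl, fun _ => hf⟩

open scoped Classical in
-- For fixed records, moving from `u` to `f u` is injective on walk states by `eq_of_next_eq`, its
-- values are occupied, and for acyclic `f` it never returns to the starting node `i`. So inflow
-- into `v` is counted at most once.
theorem sum_next_le_sum_occupied (S : Set (Fin n)) (i : Fin n) (f : Fin n → Option (Fin n))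
    (h : Fin n → ℝ≥0∞) :
    ((if Acyclic f then h i else 0) +
      ∑ u with Occupied S i u f ∧ u ∉ Reached f S, (f u).elim 0 h) ≤
      ∑ v with Occupied S i v f, h v := by
  set U : Finset (Fin n) := Finset.univ.filter fun u =>
    (Occupied S i u f ∧ u ∉ Reached f S) ∧ f u ≠ none with hU
  set next : Fin n → Fin n := fun u => (f u).getD u with hnext
  have hsome : ∀ u ∈ U, f u = some (next u) := by
    intro u hu
    obtain ⟨v, hv⟩ := Option.ne_none_iff_exists'.1 (Finset.mem_filter.1 hu).2.2
    simp [hnext, hv]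
  have hinj : Set.InjOn next U := by
    intro u hu u' hu' he
    have h1 := (Finset.mem_filter.1 hu).2.1
    have h2 := (Finset.mem_filter.1 hu').2.1
    exact eq_of_next_eq h1.1.acyclic_cut h2.1.acyclic_cut h1.1.path.leads h2.1.path.leads
      (hsome u hu) (he ▸ hsome u' hu')
  have hsub : U.image next ⊆ Finset.univ.filter fun v => Occupied S i v f := by
    intro v hv
    obtain ⟨u, hu, rfl⟩ := Finset.mem_image.1 hv
    have h1 := (Finset.mem_filter.1 hu).2.1
    exact Finset.mem_filter.2 ⟨Finset.mem_univ _, h1.1.next h1.2 (hsome u hu)⟩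
  have hsum : ∑ u with Occupied S i u f ∧ u ∉ Reached f S, (f u).elim 0 h =
      ∑ v ∈ U.image next, h v := by
    rw [Finset.sum_image hinj, hU,
      ← Finset.filter_filter (fun u => Occupied S i u f ∧ u ∉ Reached f S) (fun u => f u ≠ none),
      Finset.sum_filter (fun u => f u ≠ none)]
    refine Finset.sum_congr rfl fun u _ => ?_
    cases hf : f u with
    | none => simp
    | some v => simp [hnext, hf]
  rw [hsum]
  split_ifs with hf
  · have hi : i ∉ U.image next := by
      intro hi
      obtain ⟨u, hu, he⟩ := Finset.mem_image.1 hi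
      exact hf.not_leads (he ▸ hsome u hu) (Finset.mem_filter.1 hu).2.1.1.path.leads
    rw [← Finset.sum_insert hi]
    refine Finset.sum_le_sum_of_subset (Finset.insert_subset ?_ hsub)
    exact Finset.mem_filter.2 ⟨Finset.mem_univ _, occupied_self S i hf⟩
  · rw [zero_add]
    exact Finset.sum_le_sum_of_subset hsub

open scoped Classical in
theorem sum_ends_eq (S : Set (Fin n)) (i : Fin n) (f : Fin n → Option (Fin n)) (c : ℝ≥0∞) :
    (∑ u, if Occupied S i u f ∧ (u ∈ Reached f S ∨ f u = none) then c else 0) =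
      if Acyclic f then c else 0 := by
  split_ifs with hf
  · obtain ⟨r, hr⟩ := hf i
    obtain ⟨u, hu, hu'⟩ := exists_pathAvoiding (A := Reached f S) hr
    rw [Finset.sum_eq_single u]
    · exact if_pos ⟨⟨hf.update_none u, hu, fun _ => hf⟩, hu'⟩
    · intro v _ hv
      refine if_neg ?_
      rintro ⟨h1, h2⟩
      exact hv (h1.path.end_unique hu h2 hu')
    · simp
  · refine Finset.sum_eq_zero fun u _ => if_neg ?_
    rintro ⟨h1, h2 | h2⟩
    · exact hf (h1.acyclic h2)
    · refine hf ?_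
      have := h1.acyclic_cut
      rwa [← h2, Function.update_eq_self] at this

end WeightedDigraph

namespace WeightedDigraph

open PointerMap RandProg

variable {n : ℕ}

/-! ### The law of a round -/

/-- The probability of the in-forest given by a pointer map. -/
noncomputable def mapProb (G : WeightedDigraph n) (f : Fin n → Option (Fin n)) : ℝ≥0∞ :=
  G.forestPMF (pointerArcs f)

open scoped Classical in
theorem mapProb_eq (G : WeightedDigraph n) (f : Fin n → Option (Fin n)) :
    G.mapProb f = if Acyclic f then ENNReal.ofReal (G.density f) else 0 :=
  G.forestPMF_pointerArcs f

theorem sum_mapProb (G : WeightedDigraph n) : ∑ f, G.mapProb f = 1 := by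
  have h := G.forestPMF.tsum_coe
  rwa [tsum_fintype, sum_eq_sum_pointerArcs _ fun F => G.exists_pointerArcs_of_forestPMF_ne_zero]
    at h

theorem mapProb_ne_top (G : WeightedDigraph n) (f : Fin n → Option (Fin n)) :
    G.mapProb f ≠ ∞ := PMF.apply_ne_top _ _

open scoped Classical in
/-- The mass of the walks from `i` being at `u` with records `f`. -/
noncomputable def walkMass (G : WeightedDigraph n) (S : Set (Fin n)) (i u : Fin n)
    (f : Fin n → Option (Fin n)) : ℝ≥0∞ :=
  if Occupied S i u f ∧ u ∉ Reached f S then ENNReal.ofReal (G.density f) else 0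

open scoped Classical in
/-- The mass of the walks from `i` hitting the forest at `u` with records `f`. -/
noncomputable def hitMass (G : WeightedDigraph n) (S : Set (Fin n)) (i u : Fin n)
    (f : Fin n → Option (Fin n)) : ℝ≥0∞ :=
  if Occupied S i u f ∧ u ∈ Reached f S then ENNReal.ofReal (G.density f) else 0

theorem walkMass_ne_top (G : WeightedDigraph n) (S : Set (Fin n)) (i u : Fin n)
    (f : Fin n → Option (Fin n)) : G.walkMass S i u f ≠ ∞ := by
  unfold walkMass
  split_ifs <;> simp

/-- A step of the walk from `u` resamples the record of `u`. -/
theorem sum_walkMass_resample (G : WeightedDigraph n) (S : Set (Fin n)) (i u : Fin n)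
    (H : (Fin n → Option (Fin n)) → ℝ≥0∞) :
    ∑ f, G.walkMass S i u f * ∑ c, G.stepProb u c * H (Function.update f u c) =
      ∑ f, G.walkMass S i u f * H f := by
  classical
  -- Detailed balance: being at `u` does not depend on the pointer of `u`, and the densities satisfy
  -- the exchange identity.
  have h1 : ∀ f c, G.walkMass S i u f * G.stepProb u c =
      G.walkMass S i u (Function.update f u c) * G.stepProb u (f u) := by
    intro f c
    unfold walkMass stepProb
    simp only [occupied_update_iff]
    split_ifs
    · rw [← ENNReal.ofReal_mul (G.density_nonneg _), ← ENNReal.ofReal_mul (G.density_nonneg _),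
        mul_div_assoc', mul_div_assoc', density_mul_pointerWeight]
    · simp
  simp only [Finset.mul_sum, ← mul_assoc]
  rw [sum_swap_pointer u]
  refine Finset.sum_congr rfl fun f _ => ?_
  simp only [← h1, Function.update_idem, Function.update_eq_self]
  rw [← Finset.sum_mul, ← Finset.mul_sum, sum_stepProb, mul_one]

/-- By resampling, the move just drawn is distributed as the pointer of `u` that is already present
in `f`. -/
theorem sum_walkMass_step (G : WeightedDigraph n) (S : Set (Fin n)) (i u : Fin n)
    (h : (Fin n → Option (Fin n)) → Fin n → ℝ≥0∞) :
    ∑ f, G.walkMass S i u f *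
      ∑ v, G.stepProb u (some v) * h (Function.update f u (some v)) v =
      ∑ f, G.walkMass S i u f * (f u).elim 0 (h f) := by
  rw [← G.sum_walkMass_resample S i u fun f => (f u).elim 0 (h f)]
  refine Finset.sum_congr rfl fun f _ => ?_
  rw [Fintype.sum_option]
  simp

theorem sum_walkMass_absorb (G : WeightedDigraph n) (S : Set (Fin n)) (i u : Fin n)
    (h : (Fin n → Option (Fin n)) → ℝ≥0∞) :
    ∑ f, G.walkMass S i u f * (G.stepProb u none * h (Function.update f u none)) =
      ∑ f, G.walkMass S i u f * if f u = none then h f else 0 := by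
  rw [← G.sum_walkMass_resample S i u fun f => if f u = none then h f else 0]
  refine Finset.sum_congr rfl fun f _ => ?_
  rw [Fintype.sum_option]
  simp

/-- The balance of the flow of the walk. -/
theorem sum_mapProb_add_sum_walkMass_le (G : WeightedDigraph n) (S : Set (Fin n)) (i : Fin n)
    (h : (Fin n → Option (Fin n)) → Fin n → ℝ≥0∞) :
    ∑ f, G.mapProb f * h f i + ∑ u, ∑ f, G.walkMass S i u f *
        ∑ v, G.stepProb u (some v) * h (Function.update f u (some v)) v ≤
      ∑ u, ∑ f, G.walkMass S i u f * h f u + ∑ u, ∑ f, G.hitMass S i u f * h f u := by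
  classical
  simp only [sum_walkMass_step]
  rw [Finset.sum_comm, ← Finset.sum_add_distrib, Finset.sum_comm (γ := Fin n),
    Finset.sum_comm (γ := Fin n), ← Finset.sum_add_distrib]
  refine Finset.sum_le_sum fun f _ => ?_
  have key := mul_le_mul_right (sum_next_le_sum_occupied S i f (h f))
    (ENNReal.ofReal (G.density f))
  rw [mul_add, Finset.mul_sum, Finset.mul_sum, Finset.sum_filter, Finset.sum_filter] at key
  refine le_trans (le_of_eq ?_) (key.trans (le_of_eq ?_))
  · congr 1
    · rw [mapProb_eq]
      split_ifs <;> simp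
    · refine Finset.sum_congr rfl fun u _ => ?_
      unfold walkMass
      split_ifs <;> simp
  · rw [← Finset.sum_add_distrib]
    refine Finset.sum_congr rfl fun u _ => ?_
    unfold walkMass hitMass
    by_cases h1 : Occupied S i u f <;> by_cases h2 : u ∈ Reached f S <;> simp [h1, h2]

/-- After resampling, absorption means that the current record of `u` is `none`. Absorptions and
hits are together the ends counted by `sum_ends_eq`, one for each acyclic `f`. -/
theorem sum_exit (G : WeightedDigraph n) (S : Set (Fin n)) (i : Fin n)
    (h : (Fin n → Option (Fin n)) → ℝ≥0∞) :
    ∑ u, ∑ f, G.walkMass S i u f * (G.stepProb u none * h (Function.update f u none)) +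
      ∑ u, ∑ f, G.hitMass S i u f * h f = ∑ f, G.mapProb f * h f := by
  classical
  simp only [sum_walkMass_absorb]
  rw [Finset.sum_comm, Finset.sum_comm (γ := Fin n), ← Finset.sum_add_distrib]
  refine Finset.sum_congr rfl fun f _ => ?_
  rw [← Finset.sum_add_distrib, mapProb_eq, ite_mul, zero_mul, ← sum_ends_eq S i f]
  refine Finset.sum_congr rfl fun u _ => ?_
  unfold walkMass hitMass
  by_cases h1 : Occupied S i u f <;> by_cases h2 : u ∈ Reached f S <;>
    by_cases h3 : f u = none <;> simp [h1, h2, h3]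

/-- Bounding the values `V` of walks by iteration. -/
theorem sum_mapProb_mul_le (G : WeightedDigraph n) (S : Set (Fin n)) (i : Fin n)
    (V V' : Fin n × SampleState n → ℝ≥0∞) (hVV' : ∀ p, V p ≤ V' p) (hV : ∀ p, V p ≠ ∞)
    (a b : Fin n → (Fin n → Option (Fin n)) → ℝ≥0∞)
    (ha : ∀ u f, u ∉ Reached f S → V' (u, forestState S f) ≤
      a u f + ∑ v, G.stepProb u (some v) * V (v, record u v (forestState S f)))
    (hb : ∀ u f, u ∈ Reached f S → V' (u, forestState S f) ≤ b u f) :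
    ∑ f, G.mapProb f * V (i, forestState S f) ≤
      ∑ u, ∑ f, G.walkMass S i u f * a u f + ∑ u, ∑ f, G.hitMass S i u f * b u f := by
  -- `X` is the contribution of the walks that move on. It occurs on both sides of the balance and
  -- cancels because `V` is finite.
  set X : ℝ≥0∞ := ∑ u, ∑ f, G.walkMass S i u f *
    ∑ v, G.stepProb u (some v) * V (v, forestState S (Function.update f u (some v))) with hX
  have hXtop : X ≠ ∞ := by
    refine ENNReal.sum_ne_top.2 fun u _ => ENNReal.sum_ne_top.2 fun f _ =>
      ENNReal.mul_ne_top (G.walkMass_ne_top S i u f) (ENNReal.sum_ne_top.2 fun v _ =>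
        ENNReal.mul_ne_top ENNReal.ofReal_ne_top (hV _))
  have h1 := G.sum_mapProb_add_sum_walkMass_le S i fun f u => V (u, forestState S f)
  have h2 : ∑ u, ∑ f, G.walkMass S i u f * V (u, forestState S f) ≤
      ∑ u, ∑ f, G.walkMass S i u f * a u f + X := by
    rw [hX, ← Finset.sum_add_distrib]
    refine Finset.sum_le_sum fun u _ => ?_
    rw [← Finset.sum_add_distrib]
    refine Finset.sum_le_sum fun f _ => ?_
    rw [← mul_add]
    by_cases hu : u ∈ Reached f S
    · simp [walkMass, hu]
    · refine mul_le_mul_right ((hVV' _).trans ((ha u f hu).trans_eq ?_)) _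
      simp only [record_forestState hu]
  have h3 : ∑ u, ∑ f, G.hitMass S i u f * V (u, forestState S f) ≤
      ∑ u, ∑ f, G.hitMass S i u f * b u f := by
    refine Finset.sum_le_sum fun u _ => Finset.sum_le_sum fun f _ => ?_
    by_cases hu : u ∈ Reached f S
    · exact mul_le_mul_right ((hVV' _).trans (hb u f hu)) _
    · simp [hitMass, hu]
  refine (ENNReal.add_le_add_iff_right hXtop).1 (h1.trans ((add_le_add h2 h3).trans_eq ?_))
  ring

theorem sum_mul_iSup_le {ι : Type*} [Fintype ι] (a : ι → ℝ≥0∞) (V : ι → ℕ → ℝ≥0∞)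
    (hV : ∀ i, Monotone (V i)) {B : ℝ≥0∞} (h : ∀ k, ∑ i, a i * V i k ≤ B) :
    ∑ i, a i * ⨆ k, V i k ≤ B := by
  simp only [ENNReal.mul_iSup]
  rw [ENNReal.finsetSum_iSup_of_monotone (f := fun i k => a i * V i k) fun i k l hkl =>
    mul_le_mul_right (hV i hkl) _]
  exact iSup_le h

/-- The expectation of `g` over the ends of the walk from `i`. -/
noncomputable def exitSum (G : WeightedDigraph n) (S : Set (Fin n)) (i : Fin n)
    (g : Fin n × SampleState n → ℝ≥0∞) : ℝ≥0∞ :=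
  ∑ u, ∑ f, G.walkMass S i u f * (G.stepProb u none * g (u, absorb u (forestState S f))) +
    ∑ u, ∑ f, G.hitMass S i u f * g (u, forestState S f)

/-- The flow balance is only an inequality, so it first yields an upper bound, for each amount of
fuel. -/
theorem sum_ev_walk_le (G : WeightedDigraph n) (S : Set (Fin n)) (i : Fin n)
    (g : Fin n × SampleState n → ℝ≥0∞) (hg : ∀ p, g p ≤ 1) :
    ∑ f, G.mapProb f * (whileLoop unvisited G.walkBody (i, forestState S f)).ev g ≤
      G.exitSum S i g := by
  have hm : ∀ p, Monotone fun k => (whileFuel unvisited G.walkBody k p).ev g :=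
    fun p => wp_whileFuel_mono _ _ p _
  have h := fun p => wp_whileLoop unvisited G.walkBody p fun a _ => g a
  simp only [ev, h]
  refine sum_mul_iSup_le _ _ (fun f => hm _) fun k => ?_
  refine G.sum_mapProb_mul_le S i (fun p => (whileFuel unvisited G.walkBody k p).ev g)
    (fun p => (whileFuel unvisited G.walkBody (k + 1) p).ev g)
    (fun p => hm p (Nat.le_succ k)) (fun p => ?_) _ _ ?_ ?_
  · refine ne_top_of_le_ne_top ENNReal.one_ne_top ((ev_mono hg).trans ?_)
    exact mass_whileFuel_le_one _ _ (fun p => (G.mass_walkBody p).le) k p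
  · intro u f hu
    rw [ev_whileFuel_succ, if_pos (unvisited_forestState.2 hu), ev_walkBody]
    gcongr
    -- An absorbed walk stops at its next test; one extra unit of fuel makes that test available
    -- even for `k = 0`.
    refine (hm _ (Nat.le_succ k)).trans ?_
    dsimp only
    rw [ev_whileFuel_succ, unvisited_absorb]
    simp
  · intro u f hu
    rw [ev_whileFuel_succ, if_neg (fun h => unvisited_forestState.1 h hu)]

theorem exitSum_add (G : WeightedDigraph n) (S : Set (Fin n)) (i : Fin n)
    (g g' : Fin n × SampleState n → ℝ≥0∞) :
    G.exitSum S i (fun p => g p + g' p) = G.exitSum S i g + G.exitSum S i g' := by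
  simp only [exitSum, mul_add, Finset.sum_add_distrib]
  ring

theorem exitSum_one (G : WeightedDigraph n) (S : Set (Fin n)) (i : Fin n) :
    G.exitSum S i (fun _ => 1) = 1 := by
  rw [exitSum, G.sum_exit S i fun _ => 1]
  simp [sum_mapProb]

/-- The upper bound applies to `g` and to `1 - g`. Since walks halt with probability one, the two
left sides add up to one, as do the right sides; hence both bounds are equalities. -/
theorem sum_ev_walk (G : WeightedDigraph n) (S : Set (Fin n)) (i : Fin n)
    (g : Fin n × SampleState n → ℝ≥0∞) (hg : ∀ p, g p ≤ 1) :
    ∑ f, G.mapProb f * (whileLoop unvisited G.walkBody (i, forestState S f)).ev g =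
      G.exitSum S i g := by
  refine le_antisymm (G.sum_ev_walk_le S i g hg) ?_
  have h1 := G.sum_ev_walk_le S i (fun p => 1 - g p) fun p => tsub_le_self
  have hg' : ∀ p, g p + (1 - g p) = 1 := fun p => add_tsub_cancel_of_le (hg p)
  have h2 := G.exitSum_add S i g fun p => 1 - g p
  simp only [hg', exitSum_one] at h2
  have h3 : ∑ f, G.mapProb f * (whileLoop unvisited G.walkBody (i, forestState S f)).ev g +
      ∑ f, G.mapProb f *
        (whileLoop unvisited G.walkBody (i, forestState S f)).ev (fun p => 1 - g p) = 1 := by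
    rw [← Finset.sum_add_distrib]
    refine (Finset.sum_congr rfl fun f _ => ?_).trans G.sum_mapProb
    rw [← mul_add, ← ev_add]
    simp only [hg', mass_walk, mul_one]
  have htop : G.exitSum S i (fun p => 1 - g p) ≠ ∞ := by
    refine ne_top_of_le_ne_top ENNReal.one_ne_top ?_
    exact le_add_self.trans_eq h2.symm
  refine (ENNReal.add_le_add_iff_right htop).1 ?_
  exact h2.symm.trans_le (h3.symm.trans_le (add_le_add_right h1 _))

theorem ev_visitNode (G : WeightedDigraph n) (s : SampleState n) (i : Fin n)
    (g : SampleState n → ℝ≥0∞) :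
    (G.visitNode s i).ev g = (whileLoop unvisited G.walkBody (i, s)).ev fun p =>
      (whileLoop unvisited (retraceBody (p.2.root p.1)) (i, p.2)).ev fun q => g q.2 := by
  rw [visitNode_eq]
  simp only [ev_bind, ev_tick, ev_pure]

/-- Treating a node preserves the law of the records. -/
theorem sum_ev_visitNode (G : WeightedDigraph n) (S : Set (Fin n)) (i : Fin n)
    (g : SampleState n → ℝ≥0∞) :
    ∑ f, G.mapProb f * (G.visitNode (forestState S f) i).ev g =
      ∑ f, G.mapProb f * g (forestState (insert i S) f) := by
  -- It suffices to treat `g ≤ 1`, for which `sum_ev_walk` is available.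
  refine sum_mul_ev_eq_of_le_one _ _ _ (fun g hg => ?_) g
  simp only [ev_visitNode]
  rw [sum_ev_walk]
  swap
  · exact fun p => (ev_mono fun q => hg q.2).trans
      (mass_whileLoop_le_one _ _ (fun q => (mass_retraceBody _ q).le) _)
  rw [exitSum, ← G.sum_exit S i fun f => g (forestState (insert i S) f)]
  congr 1
  · refine Finset.sum_congr rfl fun u _ => Finset.sum_congr rfl fun f _ => ?_
    by_cases h : Occupied S i u f ∧ u ∉ Reached f S
    · obtain ⟨h, hu⟩ := h
      have hp : PathAvoiding (Reached f S) (Function.update f u none) u i :=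
        h.path.congr fun x hx => Function.update_of_ne hx _ _
      congr 2
      rw [ev_retrace (ρ := u), retraced_absorb hu hp.leads]
      · exact .of_leads hp.leads (.root (by simp [absorb]))
      · intro x _ hx y hxy
        change Leads (Function.update f u none) x y at hxy
        by_cases hxu : x = u
        · rw [← (hxu ▸ hxy : Leads _ u y).eq_of_none (by simp)]
          simp [absorb]
        · have hxS : x ∈ Reached f S := by
            simpa [absorb, forestState, hxu] using hx
          have hyS : y ∈ Reached f S := by
            rw [← reached_update hu none] at hxS ⊢
            exact hxy.mem_reached hxS
          by_cases hyu : y = u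
          · simp [absorb, hyu]
          · simpa [absorb, forestState, hyu] using hyS
    · simp [walkMass, h]
  · refine Finset.sum_congr rfl fun u _ => Finset.sum_congr rfl fun f _ => ?_
    by_cases h : Occupied S i u f ∧ u ∈ Reached f S
    · obtain ⟨h, hu⟩ := h
      obtain ⟨r, hr⟩ := h.acyclic hu i
      congr 1
      rw [ev_retrace (ρ := r) _ _ hr, retraced_forestState hu h.path.leads]
      intro x _ hx y hxy
      simp only [forestState, decide_eq_true_eq] at hx hxy ⊢
      exact hxy.mem_reached hx
    · simp [hitMass, h]

theorem sum_ev_foldlM_visitNode (G : WeightedDigraph n) (l : List (Fin n)) (S : Set (Fin n))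
    (g : SampleState n → ℝ≥0∞) :
    ∑ f, G.mapProb f * (List.foldlM G.visitNode (forestState S f) l).ev g =
      ∑ f, G.mapProb f * g (forestState (S ∪ {i | i ∈ l}) f) := by
  induction l generalizing S with
  | nil => simp [List.foldlM_nil, ev_pure]
  | cons i l ih =>
    simp only [List.foldlM_cons, ev_bind]
    rw [sum_ev_visitNode G S i fun s => (List.foldlM G.visitNode s l).ev g, ih]
    have : insert i S ∪ {j | j ∈ l} = S ∪ {j | j ∈ i :: l} := by
      ext x
      simp only [Set.mem_union, Set.mem_ofPred_eq, List.mem_cons, Set.mem_insert_iff]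
      tauto
    rw [this]

/-- Initial records are irrelevant, so they may be averaged over the forest law; costs are included,
which the running time needs. -/
theorem wp_foldlM_init (G : WeightedDigraph n) (g : SampleState n → ℕ → ℝ≥0∞) :
    wp (List.foldlM G.visitNode (SampleState.init n) (List.finRange n)) g =
      ∑ f, G.mapProb f * wp (List.foldlM G.visitNode (forestState ∅ f) (List.finRange n)) g := by
  simp only [← G.foldlM_visitNode_wp_eq (sameForest_init _) g]
  rw [← Finset.sum_mul, sum_mapProb, one_mul]

/-- A round samples the records of a random in-forest. -/
theorem ev_sampleForest (G : WeightedDigraph n) (g : SampleState n → ℝ≥0∞) :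
    G.sampleForest.ev g = ∑ f, G.mapProb f * g (forestState Set.univ f) := by
  rw [sampleForest_eq, ev_bind, ev_tick, ev, wp_foldlM_init]
  refine (G.sum_ev_foldlM_visitNode (List.finRange n) ∅ g).trans ?_
  have : (∅ : Set (Fin n)) ∪ {i | i ∈ List.finRange n} = Set.univ := by
    ext x
    simp
  rw [this]

/-! ### The running time of a round -/

/-- The number of nodes outside the forest. -/
def pending (s : SampleState n) : ℕ := (Finset.univ.filter fun a => s.inforest a = false).card

theorem pending_le (s : SampleState n) : pending s ≤ n :=
  (Finset.card_filter_le _ _).trans_eq (Finset.card_fin n)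

theorem pending_absorb_le (u : Fin n) (s : SampleState n) : pending (absorb u s) ≤ pending s := by
  refine Finset.card_le_card fun a ha => ?_
  have ha' : Function.update s.inforest u true a = false := (Finset.mem_filter.1 ha).2
  refine Finset.mem_filter.2 ⟨Finset.mem_univ _, ?_⟩
  by_cases hau : a = u
  · simp [hau] at ha'
  · rwa [Function.update_of_ne hau] at ha'

theorem pending_attach (r : Option (Fin n)) {u : Fin n} {s : SampleState n}
    (h : s.inforest u = false) : pending (attach r u s) + 1 = pending s := by
  unfold pending
  rw [← Finset.card_erase_add_one (s := Finset.univ.filter fun a => s.inforest a = false) (a := u)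
    (by simpa using h)]
  congr 2
  ext a
  rw [Finset.mem_filter, Finset.mem_erase, Finset.mem_filter]
  change _ ∧ Function.update s.inforest u true a = false ↔ _
  by_cases hau : a = u <;> simp [hau]

/-- Amortization: an iteration costs one test and three operations and removes one pending node, and
the last test costs one more. -/
theorem expectedCost_retrace (r : Option (Fin n)) (p : Fin n × SampleState n) :
    (whileLoop unvisited (retraceBody r) p).expectedCost +
      (whileLoop unvisited (retraceBody r) p).ev (fun q => 4 * pending q.2) ≤
      1 + 4 * pending p.2 := by
  have h : ∀ k p, (whileFuel unvisited (retraceBody r) k p).expectedCost +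
      (whileFuel unvisited (retraceBody r) k p).ev (fun q => 4 * pending q.2) ≤
      1 + 4 * pending p.2 := by
    intro k
    induction k with
    | zero =>
      intro p
      rw [expectedCost_eq_wp, ev, wp_whileFuel_zero, wp_whileFuel_zero]
      simp
    | succ k ih =>
      rintro ⟨u, s⟩
      refine (add_le_add_left (expectedCost_whileFuel_succ_le _ _
        (fun p => (mass_retraceBody r p).le) k _) _).trans ?_
      rw [ev_whileFuel_succ]
      split_ifs with hc
      · simp only [expectedCost_eq_wp, ev, wp_retraceBody]
        have h1 := ih ((s.next u).getD u, attach r u s)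
        have h2 := pending_attach r (u := u) (s := s) (by simpa [unvisited] using hc)
        dsimp only at h1 ⊢
        rw [← h2]
        rw [expectedCost_eq_wp, ev] at h1
        calc _ = 4 + ((whileFuel unvisited (retraceBody r) k
                ((s.next u).getD u, attach r u s)).wp (fun _ k => (k : ℝ≥0∞)) +
              (whileFuel unvisited (retraceBody r) k
                ((s.next u).getD u, attach r u s)).wp fun q _ => 4 * pending q.2) := by
              push_cast
              ring
          _ ≤ 4 + (1 + 4 * pending (attach r u s)) := by gcongr
          _ = _ := by
              push_cast
              ring
      · simp
  have hw : (whileLoop unvisited (retraceBody r) p).wp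
      (fun q k => (k : ℝ≥0∞) + 4 * pending q.2) ≤ 1 + 4 * pending p.2 := by
    rw [wp_whileLoop]
    refine iSup_le fun k => ?_
    rw [wp_add]
    exact h k p
  rwa [wp_add] at hw

theorem ev_walk_pending_le (G : WeightedDigraph n) (p : Fin n × SampleState n) :
    (whileLoop unvisited G.walkBody p).ev (fun q => 4 * pending q.2) ≤ 4 * pending p.2 := by
  rw [ev, wp_whileLoop]
  refine iSup_le fun k => ?_
  induction k generalizing p with
  | zero =>
    rw [wp_whileFuel_zero]
    exact zero_le
  | succ k ih =>
    obtain ⟨u, s⟩ := p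
    refine (ev_whileFuel_succ unvisited G.walkBody k (u, s) _).trans_le ?_
    split_ifs
    · rw [ev_walkBody]
      calc _ ≤ G.stepProb u none * (4 * pending s) +
            ∑ v, G.stepProb u (some v) * (4 * pending s) := by
            refine add_le_add (mul_le_mul_right ((ih _).trans ?_) _)
              (Finset.sum_le_sum fun v _ => mul_le_mul_right (ih _) _)
            exact mul_le_mul_right (by exact_mod_cast pending_absorb_le u s) _
        _ = 4 * pending s := by
            rw [← Finset.sum_mul, ← add_mul, stepProb_none_add, one_mul]
    · exact le_rfl

/-- The constant is 2 + 2 for the assignments and 1 for the final test of the retrace; the rest of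
the retrace is paid for by pending nodes. -/
theorem expectedCost_visitNode (G : WeightedDigraph n) (s : SampleState n) (i : Fin n) :
    (G.visitNode s i).expectedCost + (G.visitNode s i).ev (fun t => 4 * pending t) ≤
      (whileLoop unvisited G.walkBody (i, s)).expectedCost + 5 + 4 * pending s := by
  have hr : ∀ p : Fin n × SampleState n,
      (ev (whileLoop unvisited (retraceBody (p.2.root p.1)) (i, p.2) >>=
        fun q : Fin n × SampleState n => (pure q.2 : RandProg (SampleState n))) fun _ => 1) ≤ 1 := fun p =>
    mass_bind_le_one (mass_whileLoop_le_one _ _ (fun q => (mass_retraceBody _ q).le) _)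
      fun q : Fin n × SampleState n => (ev_pure q.2 _).le
  have hc : ∀ p : Fin n × SampleState n,
      (whileLoop unvisited (retraceBody (p.2.root p.1)) (i, p.2) >>=
        fun q : Fin n × SampleState n => (pure q.2 : RandProg (SampleState n))).expectedCost ≤
      (whileLoop unvisited (retraceBody (p.2.root p.1)) (i, p.2)).expectedCost := fun p => by
    refine (expectedCost_bind_le _ _
      fun q : Fin n × SampleState n => (ev_pure q.2 _).le).trans_eq ?_
    simp only [expectedCost_pure]
    rw [ev_const, zero_mul, add_zero]
  have h1 : (G.visitNode s i).expectedCost ≤ 2 +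
      ((whileLoop unvisited G.walkBody (i, s)).expectedCost +
        (whileLoop unvisited G.walkBody (i, s)).ev fun p => 2 +
          (whileLoop unvisited (retraceBody (p.2.root p.1)) (i, p.2)).expectedCost) := by
    rw [visitNode_eq]
    refine (expectedCost_tick_bind 2 _ (mass_bind_le_one
      (mass_whileLoop_le_one _ _ (fun p => (G.mass_walkBody p).le) _) fun p =>
        mass_tick_bind_le_one fun _ => hr p)).trans ?_
    gcongr
    · simp
    refine (expectedCost_bind_le _ _ fun p => mass_tick_bind_le_one fun _ => hr p).trans ?_
    gcongr
    refine ev_mono fun p => (expectedCost_tick_bind 2 _ (hr p)).trans ?_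
    gcongr
    · simp
    · exact hc p
  rw [ev_visitNode]
  refine (add_le_add_left h1 _).trans ?_
  rw [add_assoc, add_assoc, ← ev_add]
  have h2 : ((whileLoop unvisited G.walkBody (i, s)).ev fun p => 2 +
      (whileLoop unvisited (retraceBody (p.2.root p.1)) (i, p.2)).expectedCost +
      (whileLoop unvisited (retraceBody (p.2.root p.1)) (i, p.2)).ev fun q => 4 * pending q.2) ≤
      3 + 4 * pending s := by
    calc _ ≤ (whileLoop unvisited G.walkBody (i, s)).ev fun p => 3 + 4 * pending p.2 := by
          refine ev_mono fun p => ?_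
          rw [add_assoc]
          refine (add_le_add_right (expectedCost_retrace _ _) _).trans_eq ?_
          rw [← add_assoc]
          norm_num
      _ ≤ 3 + 4 * pending s := by
          rw [ev_add, ev_const, mass_walk, mul_one]
          gcongr
          exact G.ev_walk_pending_le (i, s)
  calc _ ≤ 2 + ((whileLoop unvisited G.walkBody (i, s)).expectedCost + (3 + 4 * pending s)) := by
        gcongr
    _ = _ := by ring

theorem outCount_le_card (F : Finset (Fin n × Fin n)) (u : Fin n) : outCount F u ≤ F.card :=
  Finset.card_filter_le _ _

/-- Crude finiteness, needed for the cancellation in `sum_mapProb_mul_le`. An iteration costs one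
test and at most m + 5 operations. -/
theorem expectedCost_walkFuel_ne_top (G : WeightedDigraph n) (k : ℕ)
    (p : Fin n × SampleState n) :
    (whileFuel unvisited G.walkBody k p).expectedCost ≠ ∞ := by
  suffices h : (whileFuel unvisited G.walkBody k p).expectedCost ≤ (k * (G.arcs.card + 6) : ℕ)
    from ne_top_of_le_ne_top (ENNReal.natCast_ne_top _) h
  induction k generalizing p with
  | zero =>
    rw [expectedCost_eq_wp, wp_whileFuel_zero]
    exact zero_le
  | succ k ih =>
    refine (expectedCost_whileFuel_succ_le _ _ (fun p => (G.mass_walkBody p).le) k p).trans ?_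
    have h1 : (G.walkBody p).expectedCost ≤ (G.arcs.card + 5 : ℕ) := by
      refine (G.expectedCost_walkBody_le p.1 p.2).trans ?_
      exact_mod_cast Nat.add_le_add_right (outCount_le_card _ _) 5
    have h2 : ((G.walkBody p).ev fun s' => (whileFuel unvisited G.walkBody k s').expectedCost) ≤
        (k * (G.arcs.card + 6) : ℕ) := by
      refine (ev_mono ih).trans_eq ?_
      rw [ev_const, mass_walkBody, mul_one]
    calc _ ≤ 1 + (((G.arcs.card + 5 : ℕ) : ℝ≥0∞) + (k * (G.arcs.card + 6) : ℕ)) := by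
          gcongr
          split_ifs
          · exact add_le_add h1 h2
          · exact zero_le
      _ = _ := by
          push_cast
          ring

theorem sum_hitMass_le (G : WeightedDigraph n) (S : Set (Fin n)) (i : Fin n) :
    ∑ u, ∑ f, G.hitMass S i u f ≤ 1 := by
  rw [← G.exitSum_one S i, exitSum]
  simp only [mul_one]
  exact le_add_self

/-- The expected length of a walk, through its expected numbers of visits. -/
theorem sum_expectedCost_walk_le (G : WeightedDigraph n) (S : Set (Fin n)) (i : Fin n) :
    ∑ f, G.mapProb f *
        (whileLoop unvisited G.walkBody (i, forestState S f)).expectedCost ≤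
      1 + ∑ u, ((outCount G.arcs u + 7 : ℕ) : ℝ≥0∞) * ∑ f, G.walkMass S i u f := by
  have hm : ∀ p, Monotone fun k => (whileFuel unvisited G.walkBody k p).expectedCost :=
    fun p => wp_whileFuel_mono unvisited G.walkBody p fun _ k => (k : ℝ≥0∞)
  simp only [expectedCost_whileLoop]
  refine sum_mul_iSup_le _
    (fun f k => (whileFuel unvisited G.walkBody k (i, forestState S f)).expectedCost)
    (fun f => hm _) fun k => ?_
  -- A visit is charged one test, at most outdegree + 5 for the body, and one for the test after a
  -- possible absorption; a walk that hits the forest pays one final test.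
  refine (G.sum_mapProb_mul_le S i (fun p => (whileFuel unvisited G.walkBody k p).expectedCost)
    (fun p => (whileFuel unvisited G.walkBody (k + 1) p).expectedCost)
    (fun p => hm p (Nat.le_succ k)) (G.expectedCost_walkFuel_ne_top k)
    (fun u _ => (outCount G.arcs u + 7 : ℕ)) (fun _ _ => 1) ?_ ?_).trans ?_
  · intro u f hu
    refine (expectedCost_whileFuel_succ_le _ _ (fun p => (G.mass_walkBody p).le) k _).trans ?_
    rw [if_pos (unvisited_forestState.2 hu), ev_walkBody, ← add_assoc, ← add_assoc]
    gcongr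
    have h1 := G.expectedCost_walkBody_le u (forestState S f)
    have h2 : (whileFuel unvisited G.walkBody k
        (u, absorb u (forestState S f))).expectedCost ≤ 1 := by
      refine (hm _ (Nat.le_succ k)).trans ?_
      refine (expectedCost_whileFuel_succ_le _ _ (fun p => (G.mass_walkBody p).le) k _).trans ?_
      rw [unvisited_absorb]
      simp
    have h3 : G.stepProb u none ≤ 1 := by
      rw [← G.stepProb_none_add u]
      exact le_self_add
    calc _ ≤ 1 + ((outCount G.arcs u + 5 : ℕ) : ℝ≥0∞) + 1 * 1 := by gcongr
      _ = _ := by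
          push_cast
          ring
  · intro u f hu
    refine (expectedCost_whileFuel_succ_le _ _ (fun p => (G.mass_walkBody p).le) k _).trans ?_
    rw [if_neg (fun h => unvisited_forestState.1 h hu), add_zero]
  · simp only [mul_one, ← Finset.sum_mul]
    rw [add_comm]
    refine add_le_add (G.sum_hitMass_le S i) (Finset.sum_le_sum fun u _ => ?_)
    rw [mul_comm]

open scoped Classical in
/-- The expected number of visits to `u` until all nodes are treated, when those of `S` have
been. -/
noncomputable def remainingVisits (G : WeightedDigraph n) (S : Set (Fin n)) (u : Fin n) : ℝ≥0∞ :=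
  ENNReal.ofReal (1 + G.deg u) *
    ∑ f, if f u = none ∧ u ∉ Reached f S then G.mapProb f else 0

/-- A visit to `u` is absorbing with probability 1/(1 + d_u), so the visits amount to (1 + d_u)
times the absorptions. An absorbed `u` is a root reached from `i` but not from `S`, hence counted by
the drop in `remainingVisits`. -/
theorem sum_walkMass_add_remainingVisits_le (G : WeightedDigraph n) (S : Set (Fin n))
    (i u : Fin n) : ∑ f, G.walkMass S i u f + G.remainingVisits (insert i S) u ≤
      G.remainingVisits S u := by
  classical
  have h1 : ∑ f, G.walkMass S i u f = ENNReal.ofReal (1 + G.deg u) *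
      ∑ f, G.walkMass S i u f * if f u = none then 1 else 0 := by
    rw [← G.sum_walkMass_absorb S i u fun _ => 1]
    simp only [mul_one]
    rw [← Finset.sum_mul, mul_comm, mul_assoc, stepProb, ← ENNReal.ofReal_mul'
      (G.one_add_deg_pos u).le]
    change _ = _ * ENNReal.ofReal (1 / (1 + G.deg u) * (1 + G.deg u))
    rw [one_div_mul_cancel (G.one_add_deg_pos u).ne', ENNReal.ofReal_one, mul_one]
  rw [h1, remainingVisits, remainingVisits, ← mul_add, ← Finset.sum_add_distrib]
  refine mul_le_mul_right (Finset.sum_le_sum fun f _ => ?_) _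
  by_cases hf : f u = none
  · by_cases h : Occupied S i u f ∧ u ∉ Reached f S
    · have hac : Acyclic f := by
        have := h.1.acyclic_cut
        rwa [← hf, Function.update_eq_self] at this
      have hu : u ∈ Reached f (insert i S) := mem_reached_insert.2 (.inr h.1.path.leads)
      simp [walkMass, h, hf, hu, mapProb_eq, hac]
    · have hw : G.walkMass S i u f = 0 := if_neg h
      rw [hw, zero_mul, zero_add]
      split_ifs with h1 h2
      · exact le_rfl
      · exact absurd ⟨hf, fun h' => h1.2 (mem_reached_insert.2 (.inl h'))⟩ h2
      · exact zero_le
      · exact le_rfl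
  · simp [hf]

/-- Each node contributes 5 from `expectedCost_visitNode` and 1 from its walk. The visits telescope
through `remainingVisits`, and the potential `pending` pays for all retraces. -/
theorem sum_expectedCost_foldlM_le (G : WeightedDigraph n) (l : List (Fin n))
    (S : Set (Fin n)) :
    ∑ f, G.mapProb f * (List.foldlM G.visitNode (forestState S f) l).expectedCost ≤
      6 * l.length + ∑ u, ((outCount G.arcs u + 7 : ℕ) : ℝ≥0∞) * G.remainingVisits S u +
        ∑ f, G.mapProb f * (4 * pending (forestState S f)) := by
  induction l generalizing S with
  | nil => simp [List.foldlM_nil, expectedCost_pure]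
  | cons i l ih =>
    have hm := mass_foldlM_le_one G.visitNode G.mass_visitNode_le_one l
    have h1 : ∀ f, (List.foldlM G.visitNode (forestState S f) (i :: l)).expectedCost ≤
        (G.visitNode (forestState S f) i).expectedCost +
          (G.visitNode (forestState S f) i).ev fun s =>
            (List.foldlM G.visitNode s l).expectedCost := fun f => by
      rw [List.foldlM_cons]
      exact expectedCost_bind_le _ _ hm
    have h2 := G.sum_ev_visitNode S i fun s => (List.foldlM G.visitNode s l).expectedCost
    have h3 := G.sum_ev_visitNode S i fun s => 4 * pending s
    calc _ ≤ ∑ f, G.mapProb f * ((G.visitNode (forestState S f) i).expectedCost +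
          (G.visitNode (forestState S f) i).ev fun s =>
            (List.foldlM G.visitNode s l).expectedCost) :=
          Finset.sum_le_sum fun f _ => mul_le_mul_right (h1 f) _
      _ ≤ ∑ f, G.mapProb f * (G.visitNode (forestState S f) i).expectedCost +
          (6 * l.length + ∑ u, ((outCount G.arcs u + 7 : ℕ) : ℝ≥0∞) *
            G.remainingVisits (insert i S) u +
          ∑ f, G.mapProb f * (G.visitNode (forestState S f) i).ev fun s => 4 * pending s) := by
          simp only [mul_add, Finset.sum_add_distrib]
          -- Stationarity turns the remaining cost and potential after treating `i` into averages
          -- over fresh records for `insert i S`.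
          rw [h2, h3]
          gcongr
          exact ih (insert i S)
      _ = ∑ f, G.mapProb f * ((G.visitNode (forestState S f) i).expectedCost +
            (G.visitNode (forestState S f) i).ev fun s => 4 * pending s) +
          (6 * l.length + ∑ u, ((outCount G.arcs u + 7 : ℕ) : ℝ≥0∞) *
            G.remainingVisits (insert i S) u) := by
          simp only [mul_add, Finset.sum_add_distrib]
          ring
      _ ≤ ∑ f, G.mapProb f *
            ((whileLoop unvisited G.walkBody (i, forestState S f)).expectedCost + 5 +
              4 * pending (forestState S f)) +
          (6 * l.length + ∑ u, ((outCount G.arcs u + 7 : ℕ) : ℝ≥0∞) *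
            G.remainingVisits (insert i S) u) := by
          refine add_le_add_left (Finset.sum_le_sum fun f _ => mul_le_mul_right ?_ _) _
          exact G.expectedCost_visitNode _ i
      _ = ∑ f, G.mapProb f *
            (whileLoop unvisited G.walkBody (i, forestState S f)).expectedCost + 5 +
          ∑ f, G.mapProb f * (4 * pending (forestState S f)) +
          (6 * l.length + ∑ u, ((outCount G.arcs u + 7 : ℕ) : ℝ≥0∞) *
            G.remainingVisits (insert i S) u) := by
          simp only [mul_add, Finset.sum_add_distrib]
          rw [← Finset.sum_mul, sum_mapProb, one_mul]
      _ ≤ 1 + ∑ u, ((outCount G.arcs u + 7 : ℕ) : ℝ≥0∞) * ∑ f, G.walkMass S i u f + 5 +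
          ∑ f, G.mapProb f * (4 * pending (forestState S f)) +
          (6 * l.length + ∑ u, ((outCount G.arcs u + 7 : ℕ) : ℝ≥0∞) *
            G.remainingVisits (insert i S) u) := by
          gcongr
          exact G.sum_expectedCost_walk_le S i
      _ = 6 * (i :: l).length + ∑ u, ((outCount G.arcs u + 7 : ℕ) : ℝ≥0∞) *
            (∑ f, G.walkMass S i u f + G.remainingVisits (insert i S) u) +
          ∑ f, G.mapProb f * (4 * pending (forestState S f)) := by
          simp only [mul_add, Finset.sum_add_distrib, List.length_cons]
          push_cast
          ring
      _ ≤ _ := by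
          gcongr
          exact G.sum_walkMass_add_remainingVisits_le S i _

/-- With no node treated the sum is the probability that `u` is a root, giving (1 + d_u) Q_uu. -/
theorem remainingVisits_empty_le (G : WeightedDigraph n) {W : ℝ} (hW : ∀ i j, G.w i j ≤ W)
    (u : Fin n) : G.remainingVisits ∅ u ≤ ENNReal.ofReal (1 + W) := by
  classical
  have h : ∑ f : Fin n → Option (Fin n), (if f u = none ∧ u ∉ Reached f ∅ then G.mapProb f else 0) =
      ENNReal.ofReal (G.forestProb (G.inForestsRootedAt u u)) := by
    rw [forestProb_eq_sum, Finset.sum_filter, ENNReal.ofReal_sum_of_nonneg]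
    · refine Finset.sum_congr rfl fun f _ => ?_
      have hr : RootOf f u u ↔ f u = none := ⟨fun h => h.eq_none, .root⟩
      rw [mapProb_eq]
      by_cases h1 : Acyclic f <;> by_cases h2 : f u = none <;> simp [h1, h2, hr, reached_empty]
    · intro f _
      split_ifs <;> simp [density_nonneg]
  rw [remainingVisits, h, ← ENNReal.ofReal_mul (G.one_add_deg_pos u).le]
  exact ENNReal.ofReal_le_ofReal (G.forestProb_self_le hW u)

theorem sum_outCount (F : Finset (Fin n × Fin n)) : ∑ u, outCount F u = F.card :=
  (Finset.card_eq_sum_card_fiberwise fun e _ => Finset.mem_coe.2 (Finset.mem_univ e.1)).symm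

theorem expectedCost_sampleForest_le (G : WeightedDigraph n) {W : ℝ}
    (hW : ∀ i j, G.w i j ≤ W) : G.sampleForest.expectedCost ≤
      13 * n + (G.arcs.card + 7 * n) * ENNReal.ofReal (1 + W) := by
  rw [sampleForest_eq]
  refine (expectedCost_tick_bind _ _
    (mass_foldlM_le_one G.visitNode G.mass_visitNode_le_one _ _)).trans ?_
  rw [expectedCost_eq_wp, wp_foldlM_init]
  have h := G.sum_expectedCost_foldlM_le (List.finRange n) ∅
  simp only [expectedCost_eq_wp, List.length_finRange] at h
  have h1 : ∑ f, G.mapProb f * (4 * pending (forestState ∅ f)) ≤ (4 * n : ℝ≥0∞) := by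
    calc _ ≤ ∑ f, G.mapProb f * (4 * n) := by
          gcongr
          exact pending_le _
      _ = _ := by rw [← Finset.sum_mul, sum_mapProb, one_mul]
  have h2 : ∑ u, ((outCount G.arcs u + 7 : ℕ) : ℝ≥0∞) * G.remainingVisits ∅ u ≤
      (G.arcs.card + 7 * n) * ENNReal.ofReal (1 + W) := by
    calc _ ≤ ∑ u, ((outCount G.arcs u + 7 : ℕ) : ℝ≥0∞) * ENNReal.ofReal (1 + W) := by
          gcongr
          exact G.remainingVisits_empty_le hW _
      _ = _ := by
          rw [← Finset.sum_mul, ← Nat.cast_sum, Finset.sum_add_distrib, sum_outCount]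
          simp [mul_comm]
  -- Resetting the arrays costs 3n, the nodes 6n and the retraces 4n.
  calc _ ≤ ((3 * n : ℕ) : ℝ≥0∞) + (6 * n + (G.arcs.card + 7 * n) * ENNReal.ofReal (1 + W) +
        4 * n) := by
        gcongr
        exact h.trans (by gcongr)
    _ = _ := by
        push_cast
        ring

end WeightedDigraph

namespace WeightedDigraph

open PointerMap RandProg

variable {n : ℕ}

/-! ### The sampled in-forest -/

theorem root_forestState_univ (f : Fin n → Option (Fin n)) (i : Fin n) :
    (forestState Set.univ f).root i = rootOf f i :=
  if_pos (subset_reached f _ (Set.mem_univ i))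

theorem prob_nextArcs (G : WeightedDigraph n) (φ : Finset (Fin n × Fin n)) :
    G.sampleForest.prob (fun s => s.nextArcs = φ) = G.forestPMF φ := by
  classical
  have h := sum_eq_sum_pointerArcs (fun F => G.forestPMF F * if F = φ then 1 else 0)
    fun F hF => G.exists_pointerArcs_of_forestPMF_ne_zero (left_ne_zero_of_mul hF)
  rw [prob_eq_ev, ev_sampleForest]
  exact (Finset.sum_congr rfl fun f _ => rfl).trans (h.symm.trans (by simp))

theorem mem_inForests_of_mapProb_ne_zero (G : WeightedDigraph n) {f : Fin n → Option (Fin n)}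
    (h : G.mapProb f ≠ 0) : pointerArcs f ∈ G.inForests := by
  classical
  by_contra hF
  refine h ?_
  rw [mapProb, forestPMF_apply, forestMass, if_neg hF, zero_mul]

theorem prob_root (G : WeightedDigraph n) :
    G.sampleForest.prob (fun s => ∀ i, ∃ j, s.root i = some j ∧
      s.nextArcs ∈ G.inForestsRootedAt i j) = 1 := by
  classical
  rw [prob_eq_ev, ev_sampleForest]
  refine (Finset.sum_congr rfl fun f _ => ?_).trans G.sum_mapProb
  by_cases h : G.mapProb f = 0
  · rw [h, zero_mul]
  · have hf := G.pointerArcs_mem_inForests.1 (G.mem_inForests_of_mapProb_ne_zero h)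
    rw [if_pos, mul_one]
    intro i
    obtain ⟨j, hj⟩ := hf.2 i
    refine ⟨j, ?_, G.pointerArcs_mem_inForestsRootedAt.2 ⟨hf, hj⟩⟩
    rw [root_forestState_univ, rootOf_eq_some hj]

/-! ### The estimate -/

/-- One round of the algorithm `Sample`, updating the estimate. -/
noncomputable def sampleRound (G : WeightedDigraph n) (x : Fin n → ℝ) (τ : ℕ)
    (zhat : Fin n → ℝ) (_ : ℕ) : RandProg (Fin n → ℝ) :=
  G.sampleForest >>= fun s => tick (3 * n + 1) >>= fun _ =>
    pure fun i => zhat i + (s.root i).elim 0 x / (τ : ℝ)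

theorem sample_eq (G : WeightedDigraph n) (x : Fin n → ℝ) (τ : ℕ) :
    G.sample x τ = tick (2 * n + G.arcs.card) >>= fun _ =>
      List.foldlM (G.sampleRound x τ) (fun _ => 0) (List.range τ) >>= fun zhat =>
        tick (4 * n + 1) >>= fun _ =>
          pure (zhat, ∑ i, (zhat i - (∑ i, zhat i) / (n : ℝ)) ^ 2) := rfl

theorem ev_sampleRound (G : WeightedDigraph n) (x : Fin n → ℝ) (τ : ℕ) (zhat : Fin n → ℝ)
    (k : ℕ) (g : (Fin n → ℝ) → ℝ≥0∞) :
    (G.sampleRound x τ zhat k).ev g =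
      ∑ f, G.mapProb f * g fun i => zhat i + (rootOf f i).elim 0 x / (τ : ℝ) := by
  rw [sampleRound, ev_bind]
  simp only [ev_bind, ev_tick, ev_pure]
  rw [ev_sampleForest]
  simp only [root_forestState_univ]

theorem ev_sample (G : WeightedDigraph n) (x : Fin n → ℝ) (τ : ℕ)
    (g : (Fin n → ℝ) → ℝ≥0∞) : ((G.sample x τ).ev fun out => g out.1) =
      ev (List.foldlM (G.sampleRound x τ) (fun _ => 0) (List.range τ)) g := by
  rw [sample_eq]
  simp only [ev_bind, ev_tick, ev_pure]

theorem mass_sampleRound (G : WeightedDigraph n) (x : Fin n → ℝ) (τ : ℕ) (zhat : Fin n → ℝ)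
    (k : ℕ) : ((G.sampleRound x τ zhat k).ev fun _ => 1) = 1 := by
  rw [ev_sampleRound]
  simp [sum_mapProb]

theorem mass_sample (G : WeightedDigraph n) (x : Fin n → ℝ) (τ : ℕ) :
    ((G.sample x τ).ev fun _ => 1) = 1 := by
  rw [ev_sample G x τ fun _ => 1]
  generalize (fun _ : Fin n => (0 : ℝ)) = zhat
  induction List.range τ generalizing zhat with
  | nil => rw [List.foldlM_nil, ev_pure]
  | cons k l ih =>
    rw [List.foldlM_cons, ev_bind]
    simp only [ih]
    exact G.mass_sampleRound x τ zhat k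

theorem equilibrium_eq_sum (G : WeightedDigraph n) (x : Fin n → ℝ) (i : Fin n) :
    ∑ f, (G.mapProb f).toReal * (rootOf f i).elim 0 x = G.equilibrium x i := by
  classical
  rw [equilibrium_eq]
  simp only [forestProb_eq_sum, Finset.sum_mul]
  rw [Finset.sum_comm, Finset.sum_filter]
  refine Finset.sum_congr rfl fun f _ => ?_
  rw [mapProb_eq]
  split_ifs with hf
  · obtain ⟨r, hr⟩ := hf i
    rw [rootOf_eq_some hr, ENNReal.toReal_ofReal (G.density_nonneg f), Finset.sum_eq_single r]
    · simp [hr]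
    · intro j _ hj
      rw [if_neg fun h => hj (h.unique hr), zero_mul]
    · simp
  · simp

theorem sum_mapProb_mul_ofReal (G : WeightedDigraph n) (a : (Fin n → Option (Fin n)) → ℝ)
    (ha : ∀ f, 0 ≤ a f) : ∑ f, G.mapProb f * ENNReal.ofReal (a f) =
      ENNReal.ofReal (∑ f, (G.mapProb f).toReal * a f) := by
  rw [ENNReal.ofReal_sum_of_nonneg fun f _ => mul_nonneg ENNReal.toReal_nonneg (ha f)]
  refine Finset.sum_congr rfl fun f _ => ?_
  rw [ENNReal.ofReal_mul ENNReal.toReal_nonneg, ENNReal.ofReal_toReal (G.mapProb_ne_top f)]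

theorem sum_toReal_mapProb (G : WeightedDigraph n) : ∑ f, (G.mapProb f).toReal = 1 := by
  rw [← ENNReal.toReal_sum fun f _ => G.mapProb_ne_top f, sum_mapProb, ENNReal.toReal_one]

theorem abs_elim_le (x : Fin n → ℝ) (c : Option (Fin n)) : |c.elim 0 x| ≤ ∑ j, |x j| := by
  cases c with
  | none => simpa using Finset.sum_nonneg fun j (_ : j ∈ Finset.univ) => abs_nonneg (x j)
  | some j =>
    exact Finset.single_le_sum (f := fun j => |x j|) (fun j _ => abs_nonneg (x j))
      (Finset.mem_univ j)

theorem abs_equilibrium_le (G : WeightedDigraph n) (x : Fin n → ℝ) (i : Fin n) :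
    |G.equilibrium x i| ≤ ∑ j, |x j| := by
  rw [← equilibrium_eq_sum]
  refine (Finset.abs_sum_le_sum_abs _ _).trans ?_
  rw [← one_mul (∑ j, |x j|), ← G.sum_toReal_mapProb, Finset.sum_mul]
  refine Finset.sum_le_sum fun f _ => ?_
  rw [abs_mul, abs_of_nonneg ENNReal.toReal_nonneg]
  exact mul_le_mul_of_nonneg_left (abs_elim_le x _) ENNReal.toReal_nonneg

/-- Expectations of nonnegative functions are additive, so the estimate is shifted by `c`. As a
round lowers it by at most (∑_j |x_j|)/τ, hypothesis `h` keeps the shifted estimate nonnegative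
through all rounds in `l`; its negative part then vanishes. -/
theorem ev_rounds (G : WeightedDigraph n) (x : Fin n → ℝ) (τ : ℕ) (i : Fin n) (c : ℝ)
    (l : List ℕ) (zhat : Fin n → ℝ) (h : l.length * ((∑ j, |x j|) / τ) ≤ zhat i + c) :
    ev (List.foldlM (G.sampleRound x τ) zhat l) (fun z => ENNReal.ofReal (z i + c)) =
        ENNReal.ofReal (zhat i + c + l.length * (G.equilibrium x i / τ)) ∧
      ev (List.foldlM (G.sampleRound x τ) zhat l) (fun z => ENNReal.ofReal (-(z i + c))) = 0 := by
  set B := ∑ j, |x j| with hB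
  induction l generalizing zhat with
  | nil =>
    simp only [List.length_nil, Nat.cast_zero, zero_mul] at h
    simp only [List.foldlM_nil, ev_pure, List.length_nil, Nat.cast_zero, zero_mul, add_zero,
      true_and]
    exact ENNReal.ofReal_of_nonpos (by linarith)
  | cons k l ih =>
    have hτ : (0 : ℝ) ≤ τ := Nat.cast_nonneg τ
    simp only [List.length_cons, Nat.cast_add, Nat.cast_one, add_mul, one_mul] at h
    have he : ∀ f : Fin n → Option (Fin n), -(B / τ) ≤ (rootOf f i).elim 0 x / τ := by
      intro f
      rw [← neg_div]
      exact div_le_div_of_nonneg_right (neg_le_of_abs_le (abs_elim_le x _)) hτ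
    have hz : -(B / τ) ≤ G.equilibrium x i / τ := by
      rw [← neg_div]
      exact div_le_div_of_nonneg_right (neg_le_of_abs_le (G.abs_equilibrium_le x i)) hτ
    have hstep : ∀ f : Fin n → Option (Fin n), l.length * (B / τ) ≤
        (fun j => zhat j + (rootOf f j).elim 0 x / (τ : ℝ)) i + c := by
      intro f
      have := he f
      dsimp only
      linarith
    have hih := fun f => ih (fun j => zhat j + (rootOf f j).elim 0 x / (τ : ℝ)) (hstep f)
    simp only [List.foldlM_cons, ev_bind, ev_sampleRound]
    simp only [fun f => (hih f).1, fun f => (hih f).2]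
    refine ⟨?_, by simp⟩
    rw [sum_mapProb_mul_ofReal]
    · congr 1
      have h1 : ∀ f, (G.mapProb f).toReal * (zhat i + (rootOf f i).elim 0 x / (τ : ℝ) + c +
          l.length * (G.equilibrium x i / τ)) =
          (G.mapProb f).toReal * (zhat i + c + l.length * (G.equilibrium x i / τ)) +
          (G.mapProb f).toReal * (rootOf f i).elim 0 x / τ := by
        intro f
        ring
      simp only [h1]
      rw [Finset.sum_add_distrib, ← Finset.sum_mul, sum_toReal_mapProb, ← Finset.sum_div,
        equilibrium_eq_sum]
      push_cast [List.length_cons]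
      ring
    · intro f
      have h1 := hstep f
      dsimp only at h1
      have h2 := mul_le_mul_of_nonneg_left hz (Nat.cast_nonneg (α := ℝ) l.length)
      rw [mul_neg] at h2
      linarith

theorem hasExpectation_sample (G : WeightedDigraph n) (x : Fin n → ℝ) {τ : ℕ} (hτ : 0 < τ)
    (i : Fin n) : (G.sample x τ).HasExpectation (fun out => out.1 i) (G.equilibrium x i) := by
  set B := ∑ j, |x j| with hB
  have hB0 : 0 ≤ B := Finset.sum_nonneg fun j _ => abs_nonneg (x j)
  have hτ' : (τ : ℝ) ≠ 0 := by exact_mod_cast hτ.ne'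
  -- The shift `B` is the most that τ rounds, each losing at most B/τ, can take away from zero.
  obtain ⟨h1, h2⟩ := G.ev_rounds x τ i B (List.range τ) (fun _ => 0) (by
    rw [List.length_range, mul_div_cancel₀ _ hτ', zero_add])
  rw [List.length_range, mul_div_cancel₀ _ hτ', zero_add] at h1
  rw [← G.ev_sample x τ fun z => ENNReal.ofReal (z i + B)] at h1
  rw [← G.ev_sample x τ fun z => ENNReal.ofReal (-(z i + B))] at h2
  have e1 := hasExpectation_of_ev (G.sample x τ) (fun out => out.1 i + B)
    (by rw [h1]; exact ENNReal.ofReal_ne_top) (by rw [h2]; exact ENNReal.zero_ne_top)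
  have c1 : (G.sample x τ).ev (fun _ => ENNReal.ofReal B) = ENNReal.ofReal B := by
    rw [ev_const, mass_sample, mul_one]
  have c2 : (G.sample x τ).ev (fun _ => ENNReal.ofReal (-B)) = 0 := by
    rw [ev_const, ENNReal.ofReal_of_nonpos (by linarith), zero_mul]
  have e2 := hasExpectation_of_ev (G.sample x τ) (fun _ => B)
    (by rw [c1]; exact ENNReal.ofReal_ne_top) (by rw [c2]; exact ENNReal.zero_ne_top)
  have hz : 0 ≤ B + G.equilibrium x i := by
    linarith [neg_le_of_abs_le (G.abs_equilibrium_le x i)]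
  rw [h1, h2, ENNReal.toReal_ofReal hz, ENNReal.toReal_zero, sub_zero] at e1
  rw [c1, c2, ENNReal.toReal_ofReal hB0, ENNReal.toReal_zero, sub_zero] at e2
  -- Subtracting the expectation of the constant `B` undoes the shift.
  have e := HasSum.sub e1 e2
  rw [add_sub_cancel_left] at e
  unfold HasExpectation
  rw [show (fun o : ((Fin n → ℝ) × ℝ) × ℕ => (G.sample x τ o).toReal * o.1.1 i) = _ from
    funext fun o => ?_]
  · exact e
  · ring

/-! ### The running time -/

theorem expectedCost_rounds_le (G : WeightedDigraph n) (x : Fin n → ℝ) (τ : ℕ) (l : List ℕ)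
    (zhat : Fin n → ℝ) : (List.foldlM (G.sampleRound x τ) zhat l).expectedCost ≤
      l.length * (G.sampleForest.expectedCost + (3 * n + 1)) := by
  have hf : G.sampleForest.ev (fun _ => 1) = 1 := by
    rw [ev_sampleForest]
    simp [sum_mapProb]
  induction l generalizing zhat with
  | nil => simp [List.foldlM_nil, expectedCost_pure]
  | cons k l ih =>
    rw [List.foldlM_cons]
    refine (expectedCost_bind_le _ _ fun z => mass_foldlM_le_one _
      (fun z k => (G.mass_sampleRound x τ z k).le) l z).trans ?_
    have h1 : (G.sampleRound x τ zhat k).expectedCost ≤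
        G.sampleForest.expectedCost + (3 * n + 1) := by
      refine (expectedCost_bind_le _ _ fun s => mass_tick_bind_le_one fun _ =>
        (ev_pure _ _).le).trans ?_
      gcongr
      refine (ev_mono (g' := fun _ => 3 * n + 1) fun s => le_of_eq ?_).trans_eq (by
        rw [ev_const, hf, mul_one])
      rw [expectedCost_tick_pure]
      push_cast
      rfl
    calc _ ≤ (G.sampleForest.expectedCost + (3 * n + 1)) +
          (G.sampleRound x τ zhat k).ev
            (fun _ => l.length * (G.sampleForest.expectedCost + (3 * n + 1))) :=
          add_le_add h1 (ev_mono ih)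
      _ = _ := by
          rw [ev_const, mass_sampleRound, mul_one, List.length_cons]
          push_cast
          ring

theorem ofReal_costBound (n m τ : ℕ) {K : ℝ} (hK : 0 ≤ K) :
    ((2 * n + m : ℕ) : ℝ≥0∞) + (τ * (13 * n + (m + 7 * n) * ENNReal.ofReal K + (3 * n + 1)) +
      (4 * n + 1 : ℕ)) = ENNReal.ofReal ((2 * n + m) +
        (τ * (13 * n + (m + 7 * n) * K + (3 * n + 1)) + (4 * n + 1))) := by
  obtain ⟨k, rfl⟩ : ∃ k : NNReal, K = k := ⟨⟨K, hK⟩, rfl⟩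
  rw [ENNReal.ofReal_coe_nnreal, ENNReal.ofReal]
  norm_cast
  rw [Real.toNNReal_coe]

theorem expectedCost_sample_le (G : WeightedDigraph n) (hn : 0 < n) (x : Fin n → ℝ) {τ : ℕ}
    (hτ : 0 < τ) {W : ℝ} (hW : ∀ i j, G.w i j ≤ W) :
    (G.sample x τ).expectedCost ≤
      ENNReal.ofReal (31 * (1 + W) * (τ * (n + G.arcs.card))) := by
  have hW0 : 0 ≤ W := (G.w_nonneg ⟨0, hn⟩ ⟨0, hn⟩).trans (hW _ _)
  have h1 : (G.sample x τ).expectedCost ≤ ((2 * n + G.arcs.card : ℕ) : ℝ≥0∞) +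
      (τ * (G.sampleForest.expectedCost + (3 * n + 1)) + (4 * n + 1 : ℕ)) := by
    have hm := fun zhat => mass_foldlM_le_one (G.sampleRound x τ)
      (fun z k => (G.mass_sampleRound x τ z k).le) (List.range τ) zhat
    rw [sample_eq]
    refine (expectedCost_tick_bind _ _ (mass_bind_le_one (hm _) fun z =>
      mass_tick_bind_le_one fun _ => (ev_pure _ _).le)).trans ?_
    gcongr
    refine (expectedCost_bind_le _ _ fun z => mass_tick_bind_le_one fun _ =>
      (ev_pure _ _).le).trans ?_
    refine add_le_add ((G.expectedCost_rounds_le x τ _ _).trans_eq (by rw [List.length_range])) ?_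
    calc _ ≤ ev (List.foldlM (G.sampleRound x τ) (fun _ => 0) (List.range τ))
          fun _ => ((4 * n + 1 : ℕ) : ℝ≥0∞) := by
          exact ev_mono fun z => (expectedCost_tick_pure _ _).le
      _ ≤ _ := by
          rw [ev_const]
          exact mul_le_of_le_one_right' (hm _)
  have h2 := G.expectedCost_sampleForest_le hW
  have hn1 : (1 : ℝ) ≤ n := by exact_mod_cast hn
  have hτ1 : (1 : ℝ) ≤ τ := by exact_mod_cast hτ
  have hm0 : (0 : ℝ) ≤ G.arcs.card := Nat.cast_nonneg _
  refine (h1.trans (add_le_add_right (add_le_add_left (mul_le_mul_right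
    (add_le_add_left h2 _) _) _) _)).trans ?_
  rw [ofReal_costBound n G.arcs.card τ (by linarith : 0 ≤ 1 + W)]
  refine ENNReal.ofReal_le_ofReal ?_
  set N : ℝ := (n : ℝ) with hN
  set m : ℝ := (G.arcs.card : ℝ) with hm
  set t : ℝ := (τ : ℝ) with ht
  -- The constant 31 is 7 + 24: the work outside the rounds is at most 7(n + m), and a round costs
  -- at most 24(1 + W)(n + m), using n ≥ 1 and W ≥ 0.
  have k1 : 2 * N + m + (4 * N + 1) ≤ 7 * (N + m) := by linarith
  have k2 : 13 * N + (m + 7 * N) * (1 + W) + (3 * N + 1) ≤ 24 * ((1 + W) * (N + m)) := by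
    nlinarith [mul_nonneg hW0 hm0, mul_nonneg hW0 (zero_le_one.trans hn1)]
  have k3 : N + m ≤ t * ((1 + W) * (N + m)) := by
    have : 1 ≤ t * (1 + W) := by nlinarith
    nlinarith
  have k4 := mul_le_mul_of_nonneg_left k2 (zero_le_one.trans hτ1)
  calc _ ≤ 7 * (N + m) + t * (24 * ((1 + W) * (N + m))) := by linarith
    _ ≤ 7 * (t * ((1 + W) * (N + m))) + t * (24 * ((1 + W) * (N + m))) := by linarith
    _ = _ := by ring

end WeightedDigraph

/-! ### The theorem for digraphs and projected hypergraphs -/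

theorem mainTheorem1 :
    ∃ C : ℝ, 0 < C ∧ ∀ n : ℕ, 0 < n →
      letI Claim : WeightedDigraph n → Prop := fun G =>
        -- `I + L` is invertible, and the opinions converge to `z = (I + L)⁻¹ x`
        IsUnit (1 + G.laplacian) ∧
        (∀ x y : Fin n → ℝ,
          Tendsto (fun k => (G.fjUpdate x)^[k] y) atTop (𝓝 (G.equilibrium x))) ∧
        -- `z_i = ∑ⱼ ℙ(φ ∈ Γ_ij) x_j`
        (∀ (x : Fin n → ℝ) (i : Fin n),
          G.equilibrium x i = ∑ j, G.forestProb (G.inForestsRootedAt i j) * x j) ∧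
        -- a round of the algorithm samples an in-forest with probability proportional to its
        -- weight, and `Rootindex[i]` is then the root of `i` in it
        (∀ φ : Finset (Fin n × Fin n),
          G.sampleForest.prob (fun s => s.nextArcs = φ) = G.forestPMF φ) ∧
        (G.sampleForest.prob (fun s => ∀ i, ∃ j, s.root i = some j ∧
          s.nextArcs ∈ G.inForestsRootedAt i j) = 1) ∧
        (∀ (x : Fin n → ℝ) (τ : ℕ), 0 < τ →
          -- the algorithm halts with probability one, and its estimate is unbiased
          (G.sample x τ).prob (fun _ => True) = 1 ∧
          (∀ i, (G.sample x τ).HasExpectation (fun out => out.1 i) (G.equilibrium x i)) ∧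
          -- expected running time `O(τ (n + m))` for bounded weights
          (∀ W : ℝ, (∀ i j, G.w i j ≤ W) →
            (G.sample x τ).expectedCost ≤
              ENNReal.ofReal (C * (1 + W) * (τ * (n + G.arcs.card)))))
      (∀ G : WeightedDigraph n, Claim G) ∧
      (∀ H : WeightedHypergraph n, Claim H.projectedDigraph) := by
  refine ⟨31, by norm_num, fun n hn => ?_⟩
  refine (fun h => ⟨h, fun H => h H.projectedDigraph⟩ : (∀ G : WeightedDigraph n, _) → _) ?_
  intro G
  refine ⟨G.isUnit_one_add_laplacian, G.tendsto_fjUpdate, G.equilibrium_eq, G.prob_nextArcs,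
    G.prob_root, fun x τ hτ => ⟨?_, G.hasExpectation_sample x hτ, fun W hW =>
      G.expectedCost_sample_le hn x hτ hW⟩⟩
  classical
  rw [RandProg.prob_eq_ev]
  simpa using G.mass_sample x τ
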